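/- Let $n\ge 2$ and $p<0$. For a compact convex set $K\subset\mathbb R^n$ with the origin in its interior, the $L_p$ surface area measure of $K$ is the Borel measure on $S^{n-1}$ given by $$S_p(K,\omega)=\int_{\nu_K^{-1}(\omega)}(x\cdot\nu_K(x))^{1-p}\,d\mathcal H^{n-1}(x),$$ where $\nu_K:\partial'K\to S^{n-1}$ is the Gauss map, $\partial'K$ is the set of boundary points of $K$ with a unique outer unit normal, and $\mathcal H^{n-1}$ is $(n-1)$-dimensional Hausdorff measure, normalised to be Lebesgue measure on hyperplanes. A polytope is the convex hull of a finite set of points with positive volume. If $P$ is a polytope and $u\in S^{n-1}$, put $h(P,u)=\max_{x\in P}x\cdot u$ and $F(P,u)=\{x\in P: x\cdot u=h(P,u)\}$; $u$ is a facet normal of $P$ if $\mathcal H^{n-1}(F(P,u))>0$. A discrete measure on $S^{n-1}$ is a measure $\sum_{k=1}^N\alpha_k\delta_{u_k}$ with finitely many distinct $u_1,\dots,u_N\in S^{n-1}$ and $0<\alpha_k<\infty$. A linear subspace $X\subset\mathbb R^n$ with $0<\dim X<n$ is essential with respect to a Borel measure $\mu$ on $S^{n-1}$ if $X\cap\operatorname{supp}\mu$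 is not contained in any closed hemisphere $\{v\in X\cap S^{n-1}: v\cdot w\ge 0\}$, $w\in X\cap S^{n-1}$. The measure $\mu$ is concentrated on a closed hemisphere if $\mu(\{v\in S^{n-1}: v\cdot w<0\})=0$ for some $w\in S^{n-1}$. **Theorem.** Let $n\ge2$, $p<0$, and let $\mu$ be a discrete measure on $S^{n-1}$. Then there is a polytope $P$ with the origin in its interior such that $\mu=S_p(P,\cdot)$ and $S_p(P,\cdot)$ has no essential subspace if and only if $\mu$ has no essential subspace and is not concentrated on a closed hemisphere. Moreover, if $\mu=\sum_{k=1}^N\alpha_k\delta_{u_k}$ has no essential subspace and is not concentrated on a closed hemisphere, then there is a polytope $P_0$ with the origin in its interior such that $S_p(P_0,\cdot)=\mu$, the facet normals of $P_0$ are exactly $u_1,\dots,u_N$, and $\alpha_k=h_k^{1-p}a_k$ for all $k$, where $h_k=h(P_0,u_k)$ and $a_k=\mathcal H^{n-1}(F(P_0,u_k))$. -/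

import Mathlib

open MeasureTheory
open scoped MeasureTheory ENNReal

namespace LpMinkowski

/-- The `n`-dimensional Euclidean space. -/
abbrev E (n : ℕ) : Type := EuclideanSpace ℝ (Fin n)

/-- The unit sphere `S^{n-1}` of `ℝⁿ`. -/
abbrev UnitSphere (n : ℕ) : Type := Metric.sphere (0 : E n) 1

/-- `u` is an outer unit normal of `K` at the point `x`. -/
def IsOuterUnitNormal {n : ℕ} (K : Set (E n)) (x : E n) (u : UnitSphere n) : Prop :=
  ∀ y ∈ K, inner ℝ y (u : E n) ≤ inner ℝ x (u : E n)

/-- `∂'K`: the boundary points of `K` that have a unique outer unit normal. -/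
def regularBoundary {n : ℕ} (K : Set (E n)) : Set (E n) :=
  {x | x ∈ frontier K ∧ ∃! u : UnitSphere n, IsOuterUnitNormal K x u}

/-- The Gauss map `ν_K : ∂'K → S^{n-1}`. -/
noncomputable def gaussMap {n : ℕ} (K : Set (E n)) (x : regularBoundary K) : UnitSphere n :=
  Classical.choose x.2.2

/-- The density `(x · ν_K(x))^{1-p}` on `∂'K`. -/
noncomputable def lpDensity {n : ℕ} (p : ℝ) (K : Set (E n)) (x : regularBoundary K) : ℝ≥0∞ :=
  ENNReal.ofReal ((inner ℝ (x : E n) (gaussMap K x : E n) : ℝ) ^ (1 - p))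

/-- The measure `H^{n-1}` on `∂'K`, where `H^{n-1}` is normalised so that it is Lebesgue measure
on hyperplanes. -/
noncomputable def boundaryMeasure {n : ℕ} (K : Set (E n)) : Measure (regularBoundary K) :=
  (μHE[n - 1] : Measure (E n)).comap Subtype.val

/-- The `L_p` surface area measure `S_p(K, ·)` on `S^{n-1}`, that is,
`S_p(K, ω) = ∫_{ν_K⁻¹(ω)} (x · ν_K(x))^{1-p} dH^{n-1}(x)` for Borel sets `ω`
(see `lpSurfaceAreaMeasure_apply`). It is used for convex bodies `K` with the origin in the
interior. -/
noncomputable def lpSurfaceAreaMeasure {n : ℕ} (p : ℝ) (K : Set (E n)) :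
    Measure (UnitSphere n) :=
  ((boundaryMeasure K).withDensity (lpDensity p K)).map (gaussMap K)

/-- A polytope: the convex hull of a finite set of points, with positive volume. -/
def IsPolytope {n : ℕ} (P : Set (E n)) : Prop :=
  (∃ s : Finset (E n), P = convexHull ℝ (s : Set (E n))) ∧ 0 < volume P

/-- The support function `h(K, u) = max {x · u : x ∈ K}` (for compact non-empty `K`). -/
noncomputable def supportFn {n : ℕ} (K : Set (E n)) (u : E n) : ℝ :=
  sSup ((fun x : E n => (inner ℝ x u : ℝ)) '' K)

/-- The support set `F(K, u) = K ∩ {x : x · u = h(K, u)}`. -/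
def supportSet {n : ℕ} (K : Set (E n)) (u : E n) : Set (E n) :=
  {x | x ∈ K ∧ inner ℝ x u = supportFn K u}

/-- The outer unit normals of the facets of `P`: the directions whose support set has positive
`(n-1)`-dimensional volume. -/
def facetNormals {n : ℕ} (P : Set (E n)) : Set (UnitSphere n) :=
  {u | 0 < (μHE[n - 1] : Measure (E n)) (supportSet P u)}

/-- A discrete measure on the sphere: a finite sum of point masses with positive weights. -/
def IsDiscrete {n : ℕ} (μ : Measure (UnitSphere n)) : Prop :=
  ∃ (U : Finset (UnitSphere n)) (α : UnitSphere n → ℝ),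
    (∀ u ∈ U, 0 < α u) ∧ μ = ∑ u ∈ U, ENNReal.ofReal (α u) • Measure.dirac u

/-- The closed hemisphere of `X ∩ S^{n-1}` with centre `w`, where `w` is a unit vector of `X`. -/
def closedHemisphere {n : ℕ} (X : Submodule ℝ (E n)) (w : E n) : Set (UnitSphere n) :=
  {v | (v : E n) ∈ X ∧ 0 ≤ (inner ℝ (v : E n) w : ℝ)}

/-- The subspace `X`, `0 < dim X < n`, is essential with respect to `μ`: the set `X ∩ supp μ` is
not concentrated on (contained in) any closed hemisphere of `X ∩ S^{n-1}`. -/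
def IsEssential {n : ℕ} (μ : Measure (UnitSphere n)) (X : Submodule ℝ (E n)) : Prop :=
  0 < Module.finrank ℝ X ∧ Module.finrank ℝ X < n ∧
    ¬ ∃ w ∈ X, ‖w‖ = 1 ∧ {v | v ∈ μ.support ∧ (v : E n) ∈ X} ⊆ closedHemisphere X w

/-- `μ` has an essential subspace. -/
def HasEssentialSubspace {n : ℕ} (μ : Measure (UnitSphere n)) : Prop :=
  ∃ X : Submodule ℝ (E n), IsEssential μ X

/-- `μ` is concentrated on a closed hemisphere of `S^{n-1}`. -/
def ConcentratedOnClosedHemisphere {n : ℕ} (μ : Measure (UnitSphere n)) : Prop :=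
  ∃ w : E n, ‖w‖ = 1 ∧ μ (closedHemisphere ⊤ w)ᶜ = 0

/-! The Gauss map of a compact set is Borel measurable, so that `lpSurfaceAreaMeasure` is given by
the integral formula. -/

theorem gaussMap_spec {n : ℕ} (K : Set (E n)) (x : regularBoundary K) :
    IsOuterUnitNormal K x (gaussMap K x) :=
  (Classical.choose_spec x.2.2).1

theorem gaussMap_eq {n : ℕ} {K : Set (E n)} {x : regularBoundary K} {u : UnitSphere n}
    (h : IsOuterUnitNormal K x u) : gaussMap K x = u :=
  ((Classical.choose_spec x.2.2).2 u h).symm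

theorem isClosed_normals {n : ℕ} (K : Set (E n)) :
    IsClosed {q : E n × UnitSphere n | IsOuterUnitNormal K q.1 q.2} := by
  have : {q : E n × UnitSphere n | IsOuterUnitNormal K q.1 q.2} =
      ⋂ y ∈ K, {q | inner ℝ y (q.2 : E n) ≤ (inner ℝ q.1 (q.2 : E n) : ℝ)} := by
    ext q; simp [IsOuterUnitNormal]
  rw [this]
  refine isClosed_biInter fun y _ => isClosed_le ?_ ?_ <;> fun_prop

theorem measurable_gaussMap {n : ℕ} (K : Set (E n)) : Measurable (gaussMap K) := by
  refine measurable_of_isClosed fun C hC => ?_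
  have h1 : IsClosed (Prod.fst '' {q : E n × UnitSphere n |
      IsOuterUnitNormal K q.1 q.2 ∧ q.2 ∈ C}) :=
    isClosedMap_fst_of_compactSpace _ ((isClosed_normals K).inter (hC.preimage continuous_snd))
  have h2 : gaussMap K ⁻¹' C = Subtype.val ⁻¹' (Prod.fst '' {q : E n × UnitSphere n |
      IsOuterUnitNormal K q.1 q.2 ∧ q.2 ∈ C}) := by
    ext x
    constructor
    · intro hx
      exact ⟨(x, gaussMap K x), ⟨gaussMap_spec K x, hx⟩, rfl⟩
    · rintro ⟨⟨y, u⟩, ⟨hu, huC⟩, rfl⟩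
      change gaussMap K x ∈ C
      rw [gaussMap_eq hu]
      exact huC
  rw [h2]
  exact measurable_subtype_coe h1.measurableSet

theorem measurableSet_regularBoundary {n : ℕ} (K : Set (E n)) :
    MeasurableSet (regularBoundary K) := by
  let A : Set (E n) := Prod.fst '' {q : E n × UnitSphere n | IsOuterUnitNormal K q.1 q.2}
  let B : ℕ → Set (E n) := fun m => Prod.fst '' {q : E n × (UnitSphere n × UnitSphere n) |
    IsOuterUnitNormal K q.1 q.2.1 ∧ IsOuterUnitNormal K q.1 q.2.2 ∧
      1 / ((m : ℝ) + 1) ≤ dist q.2.1 q.2.2}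
  have hA : IsClosed A := isClosedMap_fst_of_compactSpace _ (isClosed_normals K)
  have hB : ∀ m, IsClosed (B m) := by
    intro m
    refine isClosedMap_fst_of_compactSpace _ (IsClosed.inter ?_ (IsClosed.inter ?_ ?_))
    · exact (isClosed_normals K).preimage
        (f := fun q : E n × (UnitSphere n × UnitSphere n) => (q.1, q.2.1)) (by fun_prop)
    · exact (isClosed_normals K).preimage
        (f := fun q : E n × (UnitSphere n × UnitSphere n) => (q.1, q.2.2)) (by fun_prop)
    · exact isClosed_le (f := fun _ : E n × (UnitSphere n × UnitSphere n) => 1 / ((m : ℝ) + 1))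
        (g := fun q : E n × (UnitSphere n × UnitSphere n) => dist q.2.1 q.2.2)
        (by fun_prop) (by fun_prop)
  have h : regularBoundary K = frontier K ∩ (A \ ⋃ m, B m) := by
    ext x
    constructor
    · rintro ⟨hx, u, hu, huniq⟩
      refine ⟨hx, ⟨(x, u), hu, rfl⟩, ?_⟩
      simp only [Set.mem_iUnion, not_exists]
      rintro m ⟨⟨y, u₁, u₂⟩, ⟨h₁, h₂, hd⟩, rfl⟩
      have e : u₁ = u₂ := (huniq u₁ h₁).trans (huniq u₂ h₂).symm
      have : (0 : ℝ) < 1 / ((m : ℝ) + 1) := by positivity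
      simp only [e, dist_self] at hd
      linarith
    · rintro ⟨hx, ⟨⟨y, u⟩, hu, rfl⟩, hnot⟩
      refine ⟨hx, u, hu, fun v hv => ?_⟩
      by_contra hne
      obtain ⟨m, hm⟩ := exists_nat_one_div_lt (dist_pos.2 hne)
      exact hnot (Set.mem_iUnion.2 ⟨m, (y, v, u), ⟨hv, hu, hm.le⟩, rfl⟩)
  rw [h]
  exact isClosed_frontier.measurableSet.inter
    (hA.measurableSet.diff (MeasurableSet.iUnion fun m => (hB m).measurableSet))

/-- The defining formula of the `L_p` surface area measure. -/
theorem lpSurfaceAreaMeasure_apply {n : ℕ} (p : ℝ) (K : Set (E n)) {ω : Set (UnitSphere n)}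
    (hω : MeasurableSet ω) :
    lpSurfaceAreaMeasure p K ω = ∫⁻ x in gaussMap K ⁻¹' ω, lpDensity p K x ∂(boundaryMeasure K) := by
  rw [lpSurfaceAreaMeasure, Measure.map_apply (measurable_gaussMap K) hω,
    withDensity_apply _ (measurable_gaussMap K hω)]

theorem boundaryMeasure_apply {n : ℕ} (K : Set (E n)) (s : Set (regularBoundary K)) :
    boundaryMeasure K s = (μHE[n - 1] : Measure (E n)) (Subtype.val '' s) :=
  (MeasurableEmbedding.subtype_coe (measurableSet_regularBoundary K)).comap_apply _ _

end LpMinkowski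

namespace LpMinkowski

open Filter Topology Set

variable {n : ℕ}

/-! The solution comes from a max-min problem. For support numbers `h`, let `P = polyhedron u h` and
consider the convex function `ξ ↦ ∑ α i (h i - ξ · u i) ^ p` on the interior of `P`. As `p < 0` it
blows up at the boundary, so it has a minimum, and after a translation the minimum is at the origin;
this is `IsCritical`. Among critical `h` of volume one, `∑ α i (h i) ^ p` is maximised.

Compactness is where essential subspaces enter. Criticality is a linear relation among the `u i`
with positive coefficients `c i = α i (h i) ^ (p - 1)`. Without essential subspaces, the normals
carrying the dominant coefficients already see every direction
(`RelationsPositivelySpan.exists_uniform`). A coefficient comparable to the largest one belongs to a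
support number that is small compared with all others, so `P` lies in a ball of radius `C * h j` for
every `j` (`RelationsPositivelySpan.exists_norm_le`). Volume one then bounds the `h j` below and `P`
above, and truncation bounds the `h j` above (`exists_maximizer`).

The Euler-Lagrange equation needs no differentiation of the minimising translation: the tangent line
inequality for `t ^ p` turns maximality into the Minkowski-type inequality
`sum_mul_le_of_maximizer`, with equality at `h`. Since the derivative of the volume in `h j` is the
facet area (`hasDerivAt_polyVolume`), it gives `α j (h j) ^ (p - 1) = c * facetArea u h j`, and a
dilation removes `c`.

For the converse, the surface area measure of a polytope is not concentrated on a closed hemisphere,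
because the part of the boundary facing `-w` projects onto a set with non-empty interior in the
hyperplane orthogonal to `w`. -/

/-! ### Slicing Euclidean space by parallel hyperplanes -/

/-- The splitting of Euclidean space along `u`. -/
def sliceMap (u : E n) (q : ℝ × (Submodule.span ℝ {u})ᗮ) : E n := q.1 • u + q.2

theorem inner_slice {u : E n} (hu : ‖u‖ = 1) (s : ℝ) (y : (Submodule.span ℝ {u})ᗮ) :
    inner ℝ (s • u + (y : E n)) u = s := by
  have hy : inner ℝ (y : E n) u = 0 := Submodule.mem_orthogonal_singleton_iff_inner_left.1 y.2
  rw [inner_add_left, hy, real_inner_smul_left, real_inner_self_eq_norm_sq, hu]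
  norm_num

theorem finrank_orthogonal {u : E n} (hu : ‖u‖ = 1) :
    Module.finrank ℝ (Submodule.span ℝ {u})ᗮ + 1 = n := by
  have h := (Submodule.span ℝ {u}).finrank_add_finrank_orthogonal
  rw [finrank_span_singleton (by rintro rfl; simp at hu), finrank_euclideanSpace_fin] at h
  omega

theorem measurePreserving_sliceMap {u : E n} (hu : ‖u‖ = 1) :
    MeasurePreserving (sliceMap u) := by
  have hu2 : inner ℝ u u = (1 : ℝ) := by rw [real_inner_self_eq_norm_sq, hu]; norm_num
  let L : WithLp 2 (ℝ × (Submodule.span ℝ {u})ᗮ) →ₗᵢ[ℝ] E n :=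
    { toFun := fun q => q.fst • u + (q.snd : E n)
      map_add' := fun a b => by simp; module
      map_smul' := fun c a => by simp; module
      norm_map' := fun q => by
        have hy : inner ℝ u (q.snd : E n) = 0 :=
          Submodule.mem_orthogonal_singleton_iff_inner_right.1 q.snd.2
        have h1 : ‖q.fst • u + (q.snd : E n)‖ ^ 2 = ‖q‖ ^ 2 := by
          rw [WithLp.prod_norm_sq_eq_of_L2, norm_add_sq_real, real_inner_smul_left, hy, norm_smul,
            hu]
          simp
        exact (sq_eq_sq₀ (norm_nonneg _) (norm_nonneg _)).1 h1 }
  have hr : Module.finrank ℝ (WithLp 2 (ℝ × (Submodule.span ℝ {u})ᗮ)) =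
      Module.finrank ℝ (E n) := by
    rw [(WithLp.linearEquiv 2 ℝ _).finrank_eq, Module.finrank_prod, Module.finrank_self,
      finrank_euclideanSpace_fin, add_comm, finrank_orthogonal hu]
  exact (LinearIsometryEquiv.measurePreserving (L.toLinearIsometryEquiv hr)).comp
    (WithLp.volume_preserving_toLp ℝ (Submodule.span ℝ {u})ᗮ)

theorem isometry_slice (u : E n) (s : ℝ) :
    Isometry (fun y : (Submodule.span ℝ {u})ᗮ => s • u + (y : E n)) :=
  Isometry.of_dist_eq fun y z => by simp [Subtype.dist_eq]

theorem hausdorffMeasure_slice {u : E n} (hu : ‖u‖ = 1) (S : Set (E n)) (s : ℝ) :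
    (μHE[n - 1] : Measure (E n)) (S ∩ {x | inner ℝ x u = s}) =
      volume {y : (Submodule.span ℝ {u})ᗮ | s • u + (y : E n) ∈ S} := by
  have himg : S ∩ {x | inner ℝ x u = s} =
      (fun y : (Submodule.span ℝ {u})ᗮ => s • u + (y : E n)) ''
        {y | s • u + (y : E n) ∈ S} := by
    ext x
    constructor
    · rintro ⟨hx, hxs⟩
      have hmem : x - s • u ∈ (Submodule.span ℝ {u})ᗮ := by
        rw [Submodule.mem_orthogonal_singleton_iff_inner_left, inner_sub_left,
          real_inner_smul_left, real_inner_self_eq_norm_sq, hu]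
        rw [mem_ofPred_eq] at hxs
        rw [hxs]; norm_num
      exact ⟨⟨_, hmem⟩, by simpa using hx, by simp⟩
    · rintro ⟨y, hy, rfl⟩
      exact ⟨hy, inner_slice hu s y⟩
  have hn : n - 1 = Module.finrank ℝ (Submodule.span ℝ {u})ᗮ := by
    have := finrank_orthogonal hu
    omega
  rw [himg, (isometry_slice u s).euclideanHausdorffMeasure_image, hn,
    InnerProductSpace.euclideanHausdorffMeasure_eq_volume]

/-- As `v` is not a multiple of `u`, the functional `· ↦ v · y` does not vanish identically on the
orthogonal complement of `u`; the set is empty or lies in a proper affine subspace. -/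
theorem volume_slice_hyperplane_eq_zero {u v : E n} (hu : ‖u‖ = 1) (hv : ‖v‖ = 1) (h₁ : v ≠ u)
    (h₂ : v ≠ -u) (s b : ℝ) :
    volume {y : (Submodule.span ℝ {u})ᗮ | inner ℝ (s • u + (y : E n)) v = b} = 0 := by
  let φ : (Submodule.span ℝ {u})ᗮ →ₗ[ℝ] ℝ :=
    (innerₛₗ ℝ v) ∘ₗ (Submodule.span ℝ {u})ᗮ.subtype
  have hφ : LinearMap.ker φ ≠ ⊤ := by
    intro h
    have hmem : v ∈ (Submodule.span ℝ {u})ᗮᗮ := by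
      rw [Submodule.mem_orthogonal']
      intro y hy
      have : (⟨y, hy⟩ : (Submodule.span ℝ {u})ᗮ) ∈ LinearMap.ker φ := h ▸ Submodule.mem_top
      exact this
    rw [Submodule.orthogonal_orthogonal, Submodule.mem_span_singleton] at hmem
    obtain ⟨c, rfl⟩ := hmem
    rw [norm_smul, hu, mul_one, Real.norm_eq_abs] at hv
    rcases eq_or_eq_neg_of_abs_eq hv with rfl | rfl
    · simp at h₁
    · simp at h₂
  rcases Set.eq_empty_or_nonempty
    {y : (Submodule.span ℝ {u})ᗮ | inner ℝ (s • u + (y : E n)) v = b} with h | ⟨y₀, hy₀⟩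
  · rw [h, measure_empty]
  · refine measure_mono_null (t := (AffineSubspace.mk' y₀ (LinearMap.ker φ) : Set _)) ?_
      (Measure.addHaar_affineSubspace _ _ fun h => hφ ?_)
    · intro y hy
      simp only [SetLike.mem_coe, AffineSubspace.mem_mk', LinearMap.mem_ker, vsub_eq_sub, map_sub]
      simp only [mem_ofPred_eq, inner_add_left] at hy hy₀
      have e : ∀ z, φ z = inner ℝ (z : E n) v := fun z => real_inner_comm (z : E n) v
      rw [e, e]; linarith
    · rw [← AffineSubspace.direction_mk' y₀ (LinearMap.ker φ), h, AffineSubspace.direction_top]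

theorem hausdorffMeasure_inter_hyperplanes_eq_zero {u v : E n} (hu : ‖u‖ = 1) (hv : ‖v‖ = 1)
    (h₁ : v ≠ u) (h₂ : v ≠ -u) (s b : ℝ) :
    (μHE[n - 1] : Measure (E n)) ({x | inner ℝ x v = b} ∩ {x | inner ℝ x u = s}) = 0 := by
  rw [hausdorffMeasure_slice hu]
  exact volume_slice_hyperplane_eq_zero hu hv h₁ h₂ s b

theorem volume_inter_halfspace {u : E n} (hu : ‖u‖ = 1) {S : Set (E n)} (hS : MeasurableSet S)
    (t : ℝ) :
    volume (S ∩ {x | inner ℝ x u ≤ t}) =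
      ∫⁻ s in Iic t, volume {y : (Submodule.span ℝ {u})ᗮ | s • u + (y : E n) ∈ S} := by
  have hm : MeasurableSet (S ∩ {x | inner ℝ x u ≤ t}) :=
    hS.inter (measurableSet_le (by fun_prop) (by fun_prop))
  rw [← (measurePreserving_sliceMap hu).measure_preimage hm.nullMeasurableSet,
    Measure.volume_eq_prod, Measure.prod_apply ((measurePreserving_sliceMap hu).measurable hm),
    ← lintegral_indicator measurableSet_Iic]
  congr 1
  ext s
  by_cases hs : s ∈ Iic t
  · rw [indicator_of_mem hs]
    congr 1
    ext y
    have : s ≤ t := hs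
    simp [sliceMap, inner_slice hu, this]
  · rw [indicator_of_notMem hs]
    convert measure_empty (μ := (volume : Measure (Submodule.span ℝ {u})ᗮ))
    ext y
    have : ¬ s ≤ t := hs
    simp [sliceMap, inner_slice hu, this]

/-! ### Polyhedra with prescribed normals -/

section Polyhedron

variable {ι : Type*}

/-- The intersection of the half-spaces `{x : x · u i ≤ h i}`. -/
def polyhedron (u : ι → E n) (h : ι → ℝ) : Set (E n) := {x | ∀ i, inner ℝ x (u i) ≤ h i}

/-- The volume of `polyhedron u h`. -/
noncomputable def polyVolume (u : ι → E n) (h : ι → ℝ) : ℝ := volume.real (polyhedron u h)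

/-- No closed hemisphere contains all the `u i`. -/
def PositivelySpanning (u : ι → E n) : Prop := ∀ x : E n, x ≠ 0 → ∃ i, 0 < inner ℝ x (u i)

theorem isClosed_polyhedron (u : ι → E n) (h : ι → ℝ) : IsClosed (polyhedron u h) := by
  have : polyhedron u h = ⋂ i, {x | inner ℝ x (u i) ≤ h i} := by
    ext; simp [polyhedron]
  rw [this]
  exact isClosed_iInter fun i => isClosed_le (by fun_prop) (by fun_prop)

theorem convex_polyhedron (u : ι → E n) (h : ι → ℝ) : Convex ℝ (polyhedron u h) := by
  intro x hx y hy a b ha hb hab i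
  rw [inner_add_left, real_inner_smul_left, real_inner_smul_left]
  calc a * inner ℝ x (u i) + b * inner ℝ y (u i) ≤ a * h i + b * h i := by
        gcongr
        · exact hx i
        · exact hy i
    _ = h i := by rw [← add_mul, hab, one_mul]

theorem polyhedron_mono (u : ι → E n) {h h' : ι → ℝ} (hh : h ≤ h') :
    polyhedron u h ⊆ polyhedron u h' := fun _ hx i => (hx i).trans (hh i)

theorem polyhedron_smul (u : ι → E n) (h : ι → ℝ) {s : ℝ} (hs : 0 < s) :
    polyhedron u (s • h) = (fun x => s • x) '' polyhedron u h := by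
  ext x
  constructor
  · intro hx
    refine ⟨s⁻¹ • x, fun i => ?_, by simp [hs.ne']⟩
    rw [real_inner_smul_left, inv_mul_le_iff₀ hs]
    exact hx i
  · rintro ⟨y, hy, rfl⟩ i
    rw [real_inner_smul_left]
    exact mul_le_mul_of_nonneg_left (hy i) hs.le

theorem polyhedron_translate (u : ι → E n) (h : ι → ℝ) (ξ : E n) :
    polyhedron u (fun i => h i - inner ℝ ξ (u i)) = (fun x => x + ξ) ⁻¹' polyhedron u h := by
  ext x
  simp only [polyhedron, mem_preimage, mem_ofPred_eq, inner_add_left]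
  exact forall_congr' fun i => by constructor <;> intro h <;> linarith

theorem polyVolume_smul (u : ι → E n) (h : ι → ℝ) {s : ℝ} (hs : 0 < s) :
    polyVolume u (s • h) = s ^ n * polyVolume u h := by
  rw [polyVolume, polyhedron_smul u h hs, image_smul, measureReal_def, Measure.addHaar_smul,
    ENNReal.toReal_mul, finrank_euclideanSpace_fin, ENNReal.toReal_ofReal (abs_nonneg _),
    abs_of_pos (pow_pos hs n)]
  rfl

theorem polyVolume_translate (u : ι → E n) (h : ι → ℝ) (ξ : E n) :
    polyVolume u (fun i => h i - inner ℝ ξ (u i)) = polyVolume u h := by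
  rw [polyVolume, polyhedron_translate, measureReal_def, measure_preimage_add_right]
  rfl

variable [Fintype ι]

theorem zero_mem_interior_polyhedron (u : ι → E n) {h : ι → ℝ} (hh : ∀ i, 0 < h i) :
    0 ∈ interior (polyhedron u h) := by
  rw [mem_interior_iff_mem_nhds]
  have : ∀ i, ∀ᶠ x in 𝓝 (0 : E n), inner ℝ x (u i) < h i := fun i =>
    (show ContinuousAt (fun x : E n => inner ℝ x (u i)) 0 by fun_prop).eventually_lt_const
      (by simpa using hh i)
  filter_upwards [eventually_all.2 this] with x hx i using (hx i).le

/-- The maximum over `i` of `x · u i` is continuous and positive on the compact unit sphere;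
homogeneity does the rest. -/
theorem PositivelySpanning.exists_le_inner {u : ι → E n} (hu : PositivelySpanning u) :
    ∃ δ > 0, ∀ x : E n, x ≠ 0 → ∃ i, δ * ‖x‖ ≤ inner ℝ x (u i) := by
  rcases isEmpty_or_nonempty ι with hι | hι
  · exact ⟨1, one_pos, fun x hx => (hu x hx).imp fun i => isEmptyElim i⟩
  let f : E n → ℝ := fun x => Finset.univ.sup' Finset.univ_nonempty fun i => inner ℝ x (u i)
  have hf : Continuous f := Continuous.finset_sup'_apply _ fun i _ => by fun_prop
  have hfpos : ∀ x ∈ Metric.sphere (0 : E n) 1, 0 < f x := fun x hx => by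
    obtain ⟨i, hi⟩ := hu x (by rintro rfl; simp at hx)
    exact (Finset.lt_sup'_iff _).2 ⟨i, Finset.mem_univ _, hi⟩
  obtain ⟨δ, hδ, hδf⟩ := (isCompact_sphere (0 : E n) 1).exists_forall_le' hf.continuousOn hfpos
  refine ⟨δ, hδ, fun x hx => ?_⟩
  have hx' : 0 < ‖x‖ := norm_pos_iff.2 hx
  obtain ⟨i, -, hi⟩ := (Finset.le_sup'_iff _).1
    (hδf (‖x‖⁻¹ • x) (by simp [norm_smul, hx'.ne']))
  refine ⟨i, ?_⟩
  rwa [real_inner_smul_left, ← div_eq_inv_mul, le_div_iff₀ hx'] at hi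

theorem PositivelySpanning.isCompact_polyhedron {u : ι → E n} (hu : PositivelySpanning u)
    (h : ι → ℝ) : IsCompact (polyhedron u h) := by
  obtain ⟨δ, hδ, hδu⟩ := hu.exists_le_inner
  refine Metric.isCompact_of_isClosed_isBounded (isClosed_polyhedron u h) ?_
  refine (Metric.isBounded_closedBall (x := (0 : E n)) (r := (∑ i, |h i|) / δ)).subset ?_
  intro x hx
  rw [mem_closedBall_zero_iff, le_div_iff₀' hδ]
  by_cases hx0 : x = 0
  · rw [hx0, norm_zero, mul_zero]; positivity
  · obtain ⟨i, hi⟩ := hδu x hx0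
    exact hi.trans ((hx i).trans ((le_abs_self _).trans
      (Finset.single_le_sum (f := fun i => |h i|) (fun _ _ => abs_nonneg _) (Finset.mem_univ i))))

theorem PositivelySpanning.polyVolume_pos {u : ι → E n} (hu : PositivelySpanning u) {h : ι → ℝ}
    (hh : ∀ i, 0 < h i) : 0 < polyVolume u h :=
  ENNReal.toReal_pos (Measure.measure_pos_of_mem_nhds _
    (mem_interior_iff_mem_nhds.1 (zero_mem_interior_polyhedron u hh))).ne'
    (hu.isCompact_polyhedron h).measure_ne_top

theorem PositivelySpanning.polyVolume_mono {u : ι → E n} (hu : PositivelySpanning u)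
    {h h' : ι → ℝ} (hh : h ≤ h') : polyVolume u h ≤ polyVolume u h' :=
  measureReal_mono (polyhedron_mono u hh) (hu.isCompact_polyhedron h').measure_ne_top

/-- Near `h`, the support numbers lie between two dilates `s • h` with `s` close to `1`, whose
volumes are `s ^ n` times that of `h`. -/
theorem PositivelySpanning.continuousAt_polyVolume {u : ι → E n} (hu : PositivelySpanning u)
    {h : ι → ℝ} (hh : ∀ i, 0 < h i) : ContinuousAt (polyVolume u) h := by
  have key : Tendsto (fun s : ℝ => s ^ n * polyVolume u h) (𝓝 1) (𝓝 (polyVolume u h)) := by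
    have : ContinuousAt (fun s : ℝ => s ^ n * polyVolume u h) 1 := by fun_prop
    simpa [ContinuousAt] using this
  refine tendsto_order.2 ⟨fun a ha => ?_, fun a ha => ?_⟩
  · obtain ⟨s, hs, hs0, hs1⟩ := ((key.mono_left nhdsWithin_le_nhds).eventually_const_lt ha |>.and
      (Ioo_mem_nhdsLT (zero_lt_one' ℝ))).exists
    have : ∀ i, ∀ᶠ k in 𝓝 h, s * h i < k i := fun i =>
      (continuous_apply i).continuousAt.eventually_const_lt
        (by have := hh i; nlinarith)
    filter_upwards [eventually_all.2 this] with k hk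
    refine lt_of_lt_of_le hs ?_
    rw [← polyVolume_smul u h hs0]
    exact hu.polyVolume_mono fun i => (hk i).le
  · obtain ⟨s, hs, hs1, -⟩ := ((key.mono_left nhdsWithin_le_nhds).eventually_lt_const ha |>.and
      (Ioo_mem_nhdsGT (one_lt_two (α := ℝ)))).exists
    have : ∀ i, ∀ᶠ k in 𝓝 h, k i < s * h i := fun i =>
      (continuous_apply i).continuousAt.eventually_lt_const
        (by have := hh i; nlinarith)
    filter_upwards [eventually_all.2 this] with k hk
    refine lt_of_le_of_lt ?_ hs
    rw [← polyVolume_smul u h (one_pos.trans hs1)]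
    exact hu.polyVolume_mono fun i => (hk i).le

/-- An extreme point is determined by its set of active constraints: if `x` and `y` had the same
set, one could move from `x` a little along `y - x` in both directions. -/
theorem finite_extremePoints_polyhedron (u : ι → E n) (h : ι → ℝ) :
    ((polyhedron u h).extremePoints ℝ).Finite := by
  refine Finite.of_injOn (f := fun x : E n => {i | inner ℝ x (u i) = h i}) (t := univ)
    (fun _ _ => mem_univ _) ?_ finite_univ
  intro x hx y hy hxy
  have hxy' : ∀ i, inner ℝ x (u i) = h i → inner ℝ y (u i) = h i := fun i hi => by
    have h₁ : {i | inner ℝ x (u i) = h i} = {i | inner ℝ y (u i) = h i} := hxy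
    exact (Set.ext_iff.1 h₁ i).1 hi
  have hnear : ∀ᶠ t in 𝓝 (0 : ℝ), x + t • (y - x) ∈ polyhedron u h := by
    refine eventually_all.2 fun i => ?_
    rcases (hx.1 i).lt_or_eq with hi | hi
    · have : ContinuousAt (fun t : ℝ => inner ℝ (x + t • (y - x)) (u i)) 0 := by fun_prop
      filter_upwards [this.eventually_lt_const (by simpa using hi)] with t ht using ht.le
    · refine Eventually.of_forall fun t => ?_
      rw [inner_add_left, real_inner_smul_left, inner_sub_left, hi, hxy' i hi]
      simp
  have hneg : ∀ᶠ t in 𝓝 (0 : ℝ), x + (-t) • (y - x) ∈ polyhedron u h := by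
    have : Tendsto (fun t : ℝ => -t) (𝓝 0) (𝓝 0) := by
      simpa using (continuous_neg (G := ℝ)).tendsto 0
    exact this.eventually hnear
  obtain ⟨t, ⟨ht₁, ht₂⟩, ht⟩ := (((hnear.and hneg).filter_mono nhdsWithin_le_nhds).and
    (self_mem_nhdsWithin (a := (0 : ℝ)) (s := Ioi 0))).exists
  have ht : (0 : ℝ) < t := ht
  have hmid : x ∈ openSegment ℝ (x + t • (y - x)) (x + (-t) • (y - x)) :=
    ⟨1 / 2, 1 / 2, by norm_num, by norm_num, by norm_num, by module⟩
  have hz := hx.2 ht₁ ht₂ hmid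
  have : t • (y - x) = 0 := by simpa using hz
  rcases smul_eq_zero.1 this with h0 | h0
  · exact absurd h0 ht.ne'
  · exact (sub_eq_zero.1 h0).symm

theorem PositivelySpanning.isPolytope_polyhedron {u : ι → E n} (hu : PositivelySpanning u)
    {h : ι → ℝ} (hh : ∀ i, 0 < h i) : IsPolytope (polyhedron u h) := by
  refine ⟨⟨(finite_extremePoints_polyhedron u h).toFinset, ?_⟩, Measure.measure_pos_of_mem_nhds _
    (mem_interior_iff_mem_nhds.1 (zero_mem_interior_polyhedron u hh))⟩
  rw [Finite.coe_toFinset, 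
    ← ((finite_extremePoints_polyhedron u h).isCompact_convexHull ℝ).isClosed.closure_eq,
    closure_convexHull_extremePoints (hu.isCompact_polyhedron h) (convex_polyhedron u h)]

end Polyhedron

/-! ### Differentiating the volume with respect to one support number -/

section Derivative

variable {ι : Type*} [Fintype ι]

/-- The area of the facet of `polyhedron u h` with normal `u j`. -/
noncomputable def facetArea (u : ι → E n) (h : ι → ℝ) (j : ι) : ℝ :=
  (μHE[n - 1] : Measure (E n)).real (polyhedron u h ∩ {x | inner ℝ x (u j) = h j})

/-- No two of the unit vectors `u i` are equal or opposite. -/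
def PairwiseNonparallel (u : ι → E n) : Prop := ∀ i j, i ≠ j → u i ≠ u j ∧ u i ≠ -u j

/-- Dominated convergence: for fixed `y`, membership in the slice is locally constant in `s` unless
`y` lies on a bounding hyperplane. Those with `i ≠ j` cut the slice in a null set because normals
are not parallel; the one with `i = j` is avoided since `a < h j`. -/
theorem continuousAt_volume_slice {u : ι → E n} (hu₁ : ∀ i, ‖u i‖ = 1)
    (hu : PositivelySpanning u) (hpar : PairwiseNonparallel u) (h : ι → ℝ) {j : ι} {a : ℝ}
    (ha : a < h j) :
    ContinuousAt (fun s : ℝ => volume.real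
      {y : (Submodule.span ℝ {u j})ᗮ | s • u j + (y : E n) ∈ polyhedron u h}) a := by
  obtain ⟨R, hR⟩ := (hu.isCompact_polyhedron h).isBounded.subset_closedBall 0
  have hcont : ∀ s : ℝ, Continuous fun y : (Submodule.span ℝ {u j})ᗮ => s • u j + (y : E n) :=
    fun s => by fun_prop
  have hmeas : ∀ s : ℝ, MeasurableSet
      {y : (Submodule.span ℝ {u j})ᗮ | s • u j + (y : E n) ∈ polyhedron u h} := fun s =>
    ((isClosed_polyhedron u h).preimage (hcont s)).measurableSet
  have hint : (fun s : ℝ => volume.real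
      {y : (Submodule.span ℝ {u j})ᗮ | s • u j + (y : E n) ∈ polyhedron u h}) =
      fun s : ℝ => ∫ y, indicator
        {y : (Submodule.span ℝ {u j})ᗮ | s • u j + (y : E n) ∈ polyhedron u h}
        (fun _ => (1 : ℝ)) y := by
    ext s : 1
    rw [integral_indicator_const _ (hmeas s), smul_eq_mul, mul_one]
  rw [hint]
  refine continuousAt_of_dominated (bound := indicator
      (Metric.closedBall (0 : (Submodule.span ℝ {u j})ᗮ) (R + |a| + 1)) fun _ => (1 : ℝ))
    (Eventually.of_forall fun s =>
      (measurable_const.indicator (hmeas s)).aestronglyMeasurable) ?_ ?_ ?_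
  · filter_upwards [Metric.ball_mem_nhds a one_pos] with s hs
    refine Eventually.of_forall fun y => ?_
    by_cases hy : s • u j + (y : E n) ∈ polyhedron u h
    · have h1 := mem_closedBall_zero_iff.1 (hR hy)
      have h2 : ‖y‖ ≤ R + |a| + 1 := by
        have h3 : ‖(y : E n)‖ ≤ ‖s • u j + (y : E n)‖ + ‖s • u j‖ := by
          simpa using norm_sub_le (s • u j + (y : E n)) (s • u j)
        rw [norm_smul, hu₁, mul_one, Real.norm_eq_abs] at h3
        have h4 : |s| ≤ |a| + 1 := by
          have h5 : |s - a| < 1 := hs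
          have := abs_add_le (s - a) a
          rw [sub_add_cancel] at this
          linarith
        have h6 : ‖(y : E n)‖ = ‖y‖ := rfl
        linarith
      rw [indicator_of_mem (mem_closedBall_zero_iff.2 h2)]
      exact (norm_indicator_le_norm_self _ _).trans (by simp)
    · have h0 : indicator {y : (Submodule.span ℝ {u j})ᗮ | s • u j + (y : E n) ∈ polyhedron u h}
          (fun _ => (1 : ℝ)) y = 0 :=
        indicator_of_notMem (by exact hy) _
      rw [h0, norm_zero]
      exact indicator_nonneg (fun _ _ => zero_le_one) _
  · exact (integrable_indicator_iff Metric.isClosed_closedBall.measurableSet).2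
      (integrableOn_const (measure_closedBall_lt_top).ne)
  · have hae : ∀ᵐ y : (Submodule.span ℝ {u j})ᗮ, ∀ i, i ≠ j →
        inner ℝ (a • u j + (y : E n)) (u i) ≠ h i := by
      refine ae_all_iff.2 fun i => ?_
      by_cases hij : i = j
      · exact Eventually.of_forall fun y hy => absurd hij hy
      · have h0 := volume_slice_hyperplane_eq_zero (hu₁ j) (hu₁ i) (hpar i j hij).1
          (hpar i j hij).2 a (h i)
        filter_upwards [measure_eq_zero_iff_ae_notMem.1 h0] with y hy _ using hy
    filter_upwards [hae] with y hy
    have hcy : ∀ i, ContinuousAt (fun s : ℝ => inner ℝ (s • u j + (y : E n)) (u i)) a :=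
      fun i => by fun_prop
    have hne : ∀ i, inner ℝ (a • u j + (y : E n)) (u i) ≠ h i := fun i => by
      by_cases hij : i = j
      · rw [hij, inner_slice (hu₁ j)]; exact ha.ne
      · exact hy i hij
    refine ContinuousAt.congr (f := fun _ => indicator
      {y : (Submodule.span ℝ {u j})ᗮ | a • u j + (y : E n) ∈ polyhedron u h}
      (fun _ => (1 : ℝ)) y) continuousAt_const ?_
    have hiff : ∀ᶠ s in 𝓝 a, ∀ i, (inner ℝ (a • u j + (y : E n)) (u i) ≤ h i ↔
        inner ℝ (s • u j + (y : E n)) (u i) ≤ h i) := by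
      refine eventually_all.2 fun i => ?_
      rcases (hne i).lt_or_gt with hi | hi
      · filter_upwards [(hcy i).eventually_lt_const hi] with s hs
        exact ⟨fun _ => hs.le, fun _ => hi.le⟩
      · filter_upwards [(hcy i).eventually_const_lt hi] with s hs
        exact ⟨fun h' => absurd h' hi.not_ge, fun h' => absurd h' hs.not_ge⟩
    filter_upwards [hiff] with s hs
    exact indicator_eq_indicator (by exact forall_congr' hs) rfl

/-- By Fubini the volume is an integral of slice volumes up to height `t`, so the fundamental
theorem of calculus applies once the slice volume is continuous at `h j`. -/
theorem hasDerivAt_polyVolume [DecidableEq ι] {u : ι → E n} (hu₁ : ∀ i, ‖u i‖ = 1)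
    (hu : PositivelySpanning u) (hpar : PairwiseNonparallel u) (h : ι → ℝ) (j : ι) :
    HasDerivAt (fun t => polyVolume u (Function.update h j t)) (facetArea u h j) (h j) := by
  -- One fixed larger polyhedron, from which the polyhedra with `t` on either side of `h j` are cut
  -- off. Height `h j` lies strictly below its bound, so the slice function is continuous there.
  set k := Function.update h j (h j + 1) with hk
  set A : ℝ → ℝ := fun s => volume.real
      {y : (Submodule.span ℝ {u j})ᗮ | s • u j + (y : E n) ∈ polyhedron u k} with hA
  have hS : MeasurableSet (polyhedron u k) := (isClosed_polyhedron u k).measurableSet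
  have hcut : ∀ t ≤ h j + 1, polyhedron u (Function.update h j t) =
      polyhedron u k ∩ {x | inner ℝ x (u j) ≤ t} := by
    intro t ht
    ext x
    simp only [polyhedron, mem_ofPred_eq, mem_inter_iff, hk]
    constructor
    · intro hx
      have hj : inner ℝ x (u j) ≤ t := by simpa using hx j
      refine ⟨fun i => ?_, hj⟩
      by_cases hij : i = j
      · subst hij; simpa using hj.trans ht
      · simpa [hij] using hx i
    · rintro ⟨hx, hj⟩ i
      by_cases hij : i = j
      · subst hij; simpa using hj
      · simpa [hij] using hx i
  have hfin : ∀ s : ℝ, volume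
      {y : (Submodule.span ℝ {u j})ᗮ | s • u j + (y : E n) ∈ polyhedron u k} ≠ ∞ := by
    intro s
    have hemb : Topology.IsClosedEmbedding
        fun y : (Submodule.span ℝ {u j})ᗮ => s • u j + (y : E n) :=
      (isometry_slice (u j) s).isClosedEmbedding
    exact (hemb.isCompact_preimage (hu.isCompact_polyhedron k)).measure_ne_top
  have hmeasE : Measurable fun s : ℝ => volume
      {y : (Submodule.span ℝ {u j})ᗮ | s • u j + (y : E n) ∈ polyhedron u k} :=
    measurable_measure_prodMk_left ((measurePreserving_sliceMap (hu₁ j)).measurable hS)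
  have hmeas : Measurable A := hmeasE.ennreal_toReal
  have hlint : ∀ t, ∫⁻ s in Iic t, ENNReal.ofReal (A s) =
      volume (polyhedron u k ∩ {x | inner ℝ x (u j) ≤ t}) := by
    intro t
    rw [volume_inter_halfspace (hu₁ j) hS]
    simp only [hA, measureReal_def, ENNReal.ofReal_toReal (hfin _)]
  have hpos : ∀ s, 0 ≤ A s := fun s => measureReal_nonneg
  have hint : ∀ t, IntegrableOn A (Iic t) := by
    intro t
    refine ⟨hmeas.aestronglyMeasurable, ?_⟩
    rw [hasFiniteIntegral_iff_ofReal (Eventually.of_forall hpos), hlint]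
    exact (measure_mono inter_subset_left).trans_lt
      (hu.isCompact_polyhedron k).measure_lt_top
  have hvol : ∀ t ≤ h j + 1, polyVolume u (Function.update h j t) = ∫ s in Iic t, A s := by
    intro t ht
    rw [integral_eq_lintegral_of_nonneg_ae (Eventually.of_forall hpos)
      hmeas.aestronglyMeasurable, hlint, ← hcut t ht]
    rfl
  have hAj : facetArea u h j = A (h j) := by
    have h1 : polyhedron u h ∩ {x | inner ℝ x (u j) = h j} =
        polyhedron u k ∩ {x | inner ℝ x (u j) = h j} := by
      have h2 := hcut (h j) (by linarith)
      rw [Function.update_eq_self] at h2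
      rw [h2, inter_assoc]
      congr 1
      ext x
      simp +contextual
    rw [facetArea, h1, measureReal_def, hausdorffMeasure_slice (hu₁ j)]
    rfl
  have hcA : ContinuousAt A (h j) :=
    continuousAt_volume_slice hu₁ hu hpar k (by simp [hk])
  have hd := intervalIntegral.integral_hasDerivAt_right (a := h j) (b := h j) (f := A)
    IntervalIntegrable.refl (hmeas.stronglyMeasurable.stronglyMeasurableAtFilter) hcA
  rw [hAj]
  refine ((hd.const_add (∫ s in Iic (h j), A s))).congr_of_eventuallyEq ?_
  filter_upwards [Iio_mem_nhds (show h j < h j + 1 by linarith)] with t ht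
  rw [hvol t (le_of_lt ht), ← intervalIntegral.integral_Iic_sub_Iic (hint _) (hint _)]
  ring

end Derivative

/-! ### The extremal problem -/

/-- The graph of `t ^ p` lies above its tangent. With `x = t / s`, this is `1 + p (x - 1) ≤ 1 + p
log x ≤ exp (p log x)`, where `p < 0` reverses `log x ≤ x - 1`. -/
theorem add_mul_sub_le_rpow {p s t : ℝ} (hp : p < 0) (hs : 0 < s) (ht : 0 < t) :
    s ^ p + p * s ^ (p - 1) * (t - s) ≤ t ^ p := by
  have hx : 0 < t / s := div_pos ht hs
  have h1 : 1 + p * (t / s - 1) ≤ (t / s) ^ p := by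
    rw [Real.rpow_def_of_pos hx]
    have h2 := Real.add_one_le_exp (Real.log (t / s) * p)
    have h3 := Real.log_le_sub_one_of_pos hx
    nlinarith
  calc s ^ p + p * s ^ (p - 1) * (t - s) = s ^ p * (1 + p * (t / s - 1)) := by
        rw [Real.rpow_sub_one hs.ne']; field_simp
    _ ≤ s ^ p * (t / s) ^ p := by gcongr
    _ = t ^ p := by rw [← Real.mul_rpow hs.le hx.le, mul_div_cancel₀ _ hs.ne']

section Extremal

variable {ι : Type*} [Fintype ι]

/-- The stationarity condition of `ξ ↦ ∑ i, α i * (h i - ξ · u i) ^ p` at the origin. -/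
def IsCritical (u : ι → E n) (α : ι → ℝ) (p : ℝ) (h : ι → ℝ) : Prop :=
  ∑ i, (α i * h i ^ (p - 1)) • u i = 0

/-- Every nontrivial nonnegative linear relation among the `u i` involves a subfamily that is not
contained in a closed hemisphere. -/
def RelationsPositivelySpan (u : ι → E n) : Prop :=
  ∀ c : ι → ℝ, 0 ≤ c → c ≠ 0 → ∑ i, c i • u i = 0 →
    ∀ x : E n, x ≠ 0 → ∃ i, 0 < c i ∧ 0 < inner ℝ x (u i)

theorem sum_mul_inner (c : ι → ℝ) (u : ι → E n) (x : E n) :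
    ∑ i, c i * inner ℝ x (u i) = inner ℝ x (∑ i, c i • u i) := by
  rw [inner_sum]
  exact Finset.sum_congr rfl fun i _ => (real_inner_smul_right _ _ _).symm

theorem IsCritical.smul {u : ι → E n} {α : ι → ℝ} {p : ℝ} {h : ι → ℝ}
    (hc : IsCritical u α p h) (hh : ∀ i, 0 < h i) {s : ℝ} (hs : 0 < s) :
    IsCritical u α p (s • h) := by
  unfold IsCritical at hc ⊢
  rw [← smul_zero (s ^ (p - 1)), ← hc, Finset.smul_sum]
  refine Finset.sum_congr rfl fun i _ => ?_
  rw [smul_smul, Pi.smul_apply, smul_eq_mul, Real.mul_rpow hs.le (hh i).le]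
  congr 1
  ring

/-- Convexity makes a critical position a global minimum over translations, and lowering `h` to `k`
only increases the terms because `t ^ p` is decreasing. -/
theorem IsCritical.sum_le_sum {u : ι → E n} {α : ι → ℝ} {p : ℝ} {h k : ι → ℝ} (hp : p < 0)
    (hα : ∀ i, 0 < α i) (hc : IsCritical u α p h) (hh : ∀ i, 0 < h i) {ξ : E n}
    (hk : ∀ i, k i ≤ h i) (hξ : ∀ i, 0 < k i - inner ℝ ξ (u i)) :
    ∑ i, α i * h i ^ p ≤ ∑ i, α i * (k i - inner ℝ ξ (u i)) ^ p := by
  have h1 : ∑ i, α i * (h i ^ p + p * h i ^ (p - 1) * (h i - inner ℝ ξ (u i) - h i)) =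
      ∑ i, α i * h i ^ p := by
    have h2 : ∑ i, α i * h i ^ (p - 1) * inner ℝ ξ (u i) = 0 := by
      rw [sum_mul_inner, hc, inner_zero_right]
    rw [← sub_zero (∑ i, α i * h i ^ p), ← mul_zero p, ← h2, Finset.mul_sum,
      ← Finset.sum_sub_distrib]
    exact Finset.sum_congr rfl fun i _ => by ring
  rw [← h1]
  refine Finset.sum_le_sum fun i _ => mul_le_mul_of_nonneg_left ?_ (hα i).le
  refine (add_mul_sub_le_rpow hp (hh i) (by linarith [hξ i, hk i])).trans ?_
  exact Real.rpow_le_rpow_of_nonpos (hξ i) (by linarith [hk i]) hp.le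

/-- The translation minimises `Φ`, which exists because `Φ` blows up at the boundary of the
polyhedron. -/
theorem exists_translate_isCritical {u : ι → E n} {α : ι → ℝ} {p : ℝ} {h : ι → ℝ} (hp : p < 0)
    (hu : PositivelySpanning u) (hα : ∀ i, 0 < α i) (hh : ∀ i, 0 < h i) :
    ∃ ξ : E n, (∀ i, 0 < h i - inner ℝ ξ (u i)) ∧
      IsCritical u α p fun i => h i - inner ℝ ξ (u i) := by
  let Φ : E n → ℝ := fun ξ => ∑ i, α i * (h i - inner ℝ ξ (u i)) ^ p
  -- At distance `ε` from a bounding hyperplane a single term already exceeds `Φ 0`, so a minimiser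
  -- over the shrunken polyhedron satisfies all its constraints strictly.
  obtain ⟨ε, hε, hε0⟩ : ∃ ε : ℝ, (∀ i, ε < h i ∧ Φ 0 < α i * ε ^ p) ∧ 0 < ε := by
    refine ((eventually_all.2 fun i => ?_).and
      (self_mem_nhdsWithin (a := (0 : ℝ)) (s := Ioi 0))).exists
    refine ((eventually_lt_nhds (hh i)).filter_mono nhdsWithin_le_nhds).and ?_
    exact ((tendsto_rpow_neg_nhdsGT_zero hp).const_mul_atTop (hα i)).eventually_gt_atTop _
  have hK : IsCompact (polyhedron u fun i => h i - ε) := hu.isCompact_polyhedron _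
  have hKpos : ∀ ξ ∈ polyhedron u fun i => h i - ε, ∀ i, ε ≤ h i - inner ℝ ξ (u i) :=
    fun ξ hξ i => by linarith [hξ i]
  have hcont : ContinuousOn Φ (polyhedron u fun i => h i - ε) := by
    refine continuousOn_finsetSum _ fun i _ => continuousOn_const.mul ?_
    refine ContinuousOn.rpow_const (by fun_prop) fun ξ hξ => Or.inl ?_
    exact (hε0.trans_le (hKpos ξ hξ i)).ne'
  have h0 : (0 : E n) ∈ polyhedron u fun i => h i - ε := fun i => by
    rw [inner_zero_left]; linarith [(hε i).1]
  obtain ⟨ξ, hξK, hξmin⟩ := hK.exists_isMinOn ⟨0, h0⟩ hcont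
  have hξ : ∀ i, ε < h i - inner ℝ ξ (u i) := by
    intro i
    refine (hKpos ξ hξK i).lt_of_ne fun heq => ?_
    have h1 : Φ ξ ≤ Φ 0 := hξmin h0
    have h2 : α i * (h i - inner ℝ ξ (u i)) ^ p ≤ Φ ξ :=
      Finset.single_le_sum (f := fun i => α i * (h i - inner ℝ ξ (u i)) ^ p) (fun j _ =>
        mul_nonneg (hα j).le (Real.rpow_nonneg (hε0.le.trans (hKpos ξ hξK j)) _))
        (Finset.mem_univ i)
    rw [← heq] at h2
    linarith [(hε i).2]
  refine ⟨ξ, fun i => hε0.trans (hξ i), ?_⟩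
  -- The gradient of `Φ` at `ξ` is `-p • G`; the derivative along `G` itself is `-p * ‖G‖ ^ 2`,
  -- which must vanish.
  set G := ∑ i, (α i * (h i - inner ℝ ξ (u i)) ^ (p - 1)) • u i with hG
  have hline : ∀ i, HasDerivAt (fun t : ℝ => h i - inner ℝ (ξ + t • G) (u i))
      (-(inner ℝ G (u i))) 0 := by
    intro i
    have h1 : (fun t : ℝ => h i - inner ℝ (ξ + t • G) (u i)) =
        fun t => (h i - inner ℝ ξ (u i)) - t * inner ℝ G (u i) := by
      ext t; rw [inner_add_left, real_inner_smul_left]; ring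
    rw [h1]
    simpa using ((hasDerivAt_id (0 : ℝ)).mul_const (inner ℝ G (u i))).const_sub
      (h i - inner ℝ ξ (u i))
  have hderiv : HasDerivAt (fun t : ℝ => Φ (ξ + t • G))
      (∑ i, α i * (-(inner ℝ G (u i)) * p * (h i - inner ℝ ξ (u i)) ^ (p - 1))) 0 := by
    refine HasDerivAt.fun_sum fun i _ => HasDerivAt.const_mul _ ?_
    have h1 := (hline i).rpow_const (p := p) (Or.inl ?_)
    · simpa using h1
    · simpa using (hε0.trans (hξ i)).ne'
  have hmin : IsLocalMin (fun t : ℝ => Φ (ξ + t • G)) 0 := by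
    have h1 : ∀ᶠ t in 𝓝 (0 : ℝ), ∀ i, ε < h i - inner ℝ (ξ + t • G) (u i) :=
      eventually_all.2 fun i => (hline i).continuousAt.eventually_const_lt (by simpa using hξ i)
    filter_upwards [h1] with t ht
    rw [zero_smul, add_zero]
    exact hξmin fun i => by linarith [ht i]
  have hzero := hmin.hasDerivAt_eq_zero hderiv
  have h2 : -p * ∑ i, α i * (h i - inner ℝ ξ (u i)) ^ (p - 1) * inner ℝ G (u i) = 0 := by
    rw [← hzero, Finset.mul_sum]
    exact Finset.sum_congr rfl fun i _ => by ring
  rw [sum_mul_inner, ← hG] at h2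
  exact inner_self_eq_zero.1 ((mul_eq_zero.1 h2).resolve_left (by linarith))

/-- Nonnegative relations with largest coefficient `1` form a compact set, and so does its product
with the unit sphere; the maximum over `i` of `min (c i) (x · u i)` is continuous and positive
there. -/
theorem RelationsPositivelySpan.exists_uniform {u : ι → E n} (hu : RelationsPositivelySpan u) :
    ∃ δ > 0, ∀ c : ι → ℝ, 0 ≤ c → c ≤ 1 → (∃ i, c i = 1) → ∑ i, c i • u i = 0 →
      ∀ x : E n, ‖x‖ = 1 → ∃ i, δ ≤ c i ∧ δ ≤ inner ℝ x (u i) := by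
  rcases isEmpty_or_nonempty ι with hι | hι
  · exact ⟨1, one_pos, fun c _ _ ⟨i, _⟩ => isEmptyElim i⟩
  let Z : Set (ι → ℝ) := Icc 0 1 ∩ ((⋃ i, {c | c i = 1}) ∩ {c | ∑ i, c i • u i = 0})
  have hZ : IsCompact Z := isCompact_Icc.inter_right
    ((isClosed_iUnion_of_finite fun i => isClosed_eq (by fun_prop) (by fun_prop)).inter
      (isClosed_eq (by fun_prop) (by fun_prop)))
  let f : (ι → ℝ) × E n → ℝ := fun q =>
    Finset.univ.sup' Finset.univ_nonempty fun i => min (q.1 i) (inner ℝ q.2 (u i))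
  have hf : Continuous f := Continuous.finset_sup'_apply _ fun i _ => by fun_prop
  have hfpos : ∀ q ∈ Z ×ˢ Metric.sphere (0 : E n) 1, 0 < f q := by
    rintro ⟨c, x⟩ ⟨⟨⟨hc0, -⟩, hc1, hcu⟩, hx⟩
    obtain ⟨j, hj⟩ := mem_iUnion.1 hc1
    have hj : c j = 1 := hj
    obtain ⟨i, hi, hi'⟩ := hu c hc0 (by rintro rfl; simp at hj) hcu x
      (by rintro rfl; simp at hx)
    exact (Finset.lt_sup'_iff _).2 ⟨i, Finset.mem_univ _, lt_min hi hi'⟩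
  obtain ⟨δ, hδ, hδf⟩ :=
    (hZ.prod (isCompact_sphere (0 : E n) 1)).exists_forall_le' hf.continuousOn hfpos
  refine ⟨δ, hδ, fun c hc0 hc1 hc hcu x hx => ?_⟩
  obtain ⟨i, -, hi⟩ := (Finset.le_sup'_iff _).1
    (hδf (c, x) ⟨⟨⟨hc0, hc1⟩, mem_iUnion.2 hc, hcu⟩, by simpa using hx⟩)
  exact ⟨i, le_min_iff.1 hi⟩

/-- The key estimate. Dividing the critical relation by its largest coefficient gives, for each
direction `x`, an index `i` with `c i ≥ δ * c j` for all `j` and `x · u i ≥ δ * ‖x‖`. The first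
forces `h i ≤ D * h j`, since the exponent `p - 1` is negative; hence `δ * ‖x‖ ≤ h i ≤ D * h j`. -/
theorem RelationsPositivelySpan.exists_norm_le {u : ι → E n} {α : ι → ℝ} {p : ℝ}
    (hu : RelationsPositivelySpan u) (hp : p < 0) (hα : ∀ i, 0 < α i) :
    ∃ C > 0, ∀ h : ι → ℝ, (∀ i, 0 < h i) → IsCritical u α p h →
      ∀ j, ∀ x ∈ polyhedron u h, ‖x‖ ≤ C * h j := by
  obtain ⟨δ, hδ, hδu⟩ := hu.exists_uniform
  have hα0 : ∀ i j, 0 < α i / (δ * α j) := fun i j => div_pos (hα i) (mul_pos hδ (hα j))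
  -- A single bound for all ratios `α i / (δ * α j)`; below, `D` is chosen so that `D ^ (p - 1) =
  -- A⁻¹`.
  set A : ℝ := 1 + ∑ i, ∑ j, α i / (δ * α j) with hA
  have hA0 : 0 < A := by
    have : 0 ≤ ∑ i, ∑ j, α i / (δ * α j) :=
      Finset.sum_nonneg fun i _ => Finset.sum_nonneg fun j _ => (hα0 i j).le
    linarith
  have hAle : ∀ i j, α i < A * (δ * α j) := fun i j => by
    rw [← div_lt_iff₀ (mul_pos hδ (hα j))]
    have h1 : α i / (δ * α j) ≤ ∑ j, α i / (δ * α j) :=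
      Finset.single_le_sum (f := fun j => α i / (δ * α j)) (fun j _ => (hα0 i j).le)
        (Finset.mem_univ j)
    have h2 : ∑ j, α i / (δ * α j) ≤ ∑ i, ∑ j, α i / (δ * α j) :=
      Finset.single_le_sum (f := fun i => ∑ j, α i / (δ * α j))
        (fun i _ => Finset.sum_nonneg fun j _ => (hα0 i j).le) (Finset.mem_univ i)
    linarith
  set D : ℝ := A ^ (1 / (1 - p)) with hD
  have hD0 : 0 < D := Real.rpow_pos_of_pos hA0 _
  have hDp : D ^ (p - 1) = A⁻¹ := by
    rw [hD, ← Real.rpow_mul hA0.le, ← Real.rpow_neg_one]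
    congr 1
    have : 1 - p ≠ 0 := by linarith
    field_simp
    ring
  refine ⟨D / δ, div_pos hD0 hδ, fun h hh hc j x hx => ?_⟩
  rcases eq_or_ne x 0 with rfl | hx0
  · rw [norm_zero]
    exact (mul_pos (div_pos hD0 hδ) (hh j)).le
  let c : ι → ℝ := fun i => α i * h i ^ (p - 1)
  have hcpos : ∀ i, 0 < c i := fun i => mul_pos (hα i) (Real.rpow_pos_of_pos (hh i) _)
  obtain ⟨m, -, hm⟩ := Finset.univ.exists_max_image c ⟨j, Finset.mem_univ j⟩
  have hx1 : 0 < ‖x‖ := norm_pos_iff.2 hx0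
  obtain ⟨i, hi, hi'⟩ := hδu (fun i => c i / c m) (fun i => (div_pos (hcpos i) (hcpos m)).le)
    (fun i => (div_le_one (hcpos m)).2 (hm i (Finset.mem_univ i))) ⟨m, div_self (hcpos m).ne'⟩
    (by
      have h1 : ∑ i, (c i / c m) • u i = (c m)⁻¹ • ∑ i, c i • u i := by
        rw [Finset.smul_sum]
        exact Finset.sum_congr rfl fun i _ => by rw [smul_smul, div_eq_inv_mul]
      rw [h1, show ∑ i, c i • u i = 0 from hc, smul_zero])
    (‖x‖⁻¹ • x) (by simp [norm_smul, hx1.ne'])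
  rw [real_inner_smul_left, ← div_eq_inv_mul, le_div_iff₀ hx1] at hi'
  rw [le_div_iff₀ (hcpos m)] at hi
  have h1 : δ * c j ≤ c i :=
    (mul_le_mul_of_nonneg_left (hm j (Finset.mem_univ j)) hδ.le).trans hi
  have h2 : h i ≤ D * h j := by
    by_contra! hlt
    have h3 : h i ^ (p - 1) < A⁻¹ * h j ^ (p - 1) := by
      rw [← hDp, ← Real.mul_rpow hD0.le (hh j).le]
      exact Real.rpow_lt_rpow_of_neg (mul_pos hD0 (hh j)) hlt (by linarith)
    have h4 : c i < α i * (A⁻¹ * h j ^ (p - 1)) := mul_lt_mul_of_pos_left h3 (hα i)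
    have h5 : α i * (A⁻¹ * h j ^ (p - 1)) ≤ δ * c j := by
      have h6 : α i * A⁻¹ ≤ δ * α j := by
        rw [← div_eq_mul_inv, div_le_iff₀ hA0]
        linarith [hAle i j]
      calc α i * (A⁻¹ * h j ^ (p - 1)) = α i * A⁻¹ * h j ^ (p - 1) := by ring
        _ ≤ δ * α j * h j ^ (p - 1) :=
          mul_le_mul_of_nonneg_right h6 (Real.rpow_nonneg (hh j).le _)
        _ = δ * c j := by ring
    linarith
  rw [div_mul_eq_mul_div, le_div_iff₀ hδ]
  linarith [hx i]

end Extremal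

theorem facetArea_smul {ι : Type*} (u : ι → E n) (h : ι → ℝ) {s : ℝ} (hs : 0 < s) (j : ι) :
    facetArea u (s • h) j = s ^ (n - 1) * facetArea u h j := by
  have h1 : polyhedron u (s • h) ∩ {x | inner ℝ x (u j) = (s • h) j} =
      (fun x => s • x) '' (polyhedron u h ∩ {x | inner ℝ x (u j) = h j}) := by
    rw [image_inter (smul_right_injective _ hs.ne'), ← polyhedron_smul u h hs]
    congr 1
    ext x
    constructor
    · intro hx
      refine ⟨s⁻¹ • x, ?_, by simp [hs.ne']⟩
      rw [mem_ofPred_eq] at hx ⊢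
      rw [real_inner_smul_left, hx, Pi.smul_apply, smul_eq_mul, inv_mul_cancel_left₀ hs.ne']
    · rintro ⟨y, hy, rfl⟩
      rw [mem_ofPred_eq] at hy ⊢
      rw [real_inner_smul_left, hy, Pi.smul_apply, smul_eq_mul]
  rw [facetArea, h1, image_smul, measureReal_def,
    Measure.euclideanHausdorffMeasure_smul₀ _ hs.ne', facetArea, measureReal_def,
    ENNReal.smul_def, smul_eq_mul, ENNReal.toReal_mul]
  simp [abs_of_pos hs]

/-! ### Existence of a maximiser and its Euler-Lagrange equation -/

section Maximizer

variable {ι : Type*} [Fintype ι]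

theorem exists_isCritical_polyVolume_eq_one {u : ι → E n} {α : ι → ℝ} {p : ℝ} (hn : n ≠ 0)
    (hu : PositivelySpanning u) {h : ι → ℝ} (hh : ∀ i, 0 < h i) (hV : IsCritical u α p h) :
    ∃ k : ι → ℝ, (∀ i, 0 < k i) ∧ IsCritical u α p k ∧ polyVolume u k = 1 := by
  have hV0 := hu.polyVolume_pos hh
  set s : ℝ := (polyVolume u h)⁻¹ ^ (1 / (n : ℝ)) with hs
  have hs0 : 0 < s := Real.rpow_pos_of_pos (inv_pos.2 hV0) _
  refine ⟨s • h, fun i => mul_pos hs0 (hh i), hV.smul hh hs0, ?_⟩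
  rw [polyVolume_smul u h hs0, hs, ← Real.rpow_natCast, ← Real.rpow_mul (inv_pos.2 hV0).le,
    one_div_mul_cancel (Nat.cast_ne_zero.2 hn), Real.rpow_one, inv_mul_cancel₀ hV0.ne']

/-- The polyhedron lies in a ball of radius `C * h j`, so a tiny `h j` would contradict volume one.
-/
theorem exists_critical_lower_bound {u : ι → E n} {α : ι → ℝ} {p : ℝ} (hn : n ≠ 0)
    (hp : p < 0) (hrel : RelationsPositivelySpan u) (hα : ∀ i, 0 < α i) :
    ∃ m > 0, ∀ h : ι → ℝ, (∀ i, 0 < h i) → IsCritical u α p h → polyVolume u h = 1 →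
      ∀ j, m ≤ h j := by
  obtain ⟨C, hC, hCu⟩ := hrel.exists_norm_le hp hα
  set κ := (volume : Measure (E n)).real (Metric.ball 0 1) with hκ
  have hκ0 : 0 ≤ κ := measureReal_nonneg
  have hcont : ContinuousAt (fun m : ℝ => (C * m) ^ n * κ) 0 := by fun_prop
  obtain ⟨m, hm, hm0⟩ := (((hcont.eventually_lt_const (u := 1) (by simp [hn])).filter_mono
    nhdsWithin_le_nhds).and (self_mem_nhdsWithin (a := (0 : ℝ)) (s := Ioi 0))).exists
  refine ⟨m, hm0, fun h hh hc hV j => ?_⟩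
  by_contra! hlt
  have h1 : polyVolume u h ≤ (C * h j) ^ n * κ := by
    have hr : 0 ≤ C * h j := mul_nonneg hC.le (hh j).le
    have h2 := Measure.addHaar_real_closedBall (volume : Measure (E n)) 0 hr
    rw [finrank_euclideanSpace_fin] at h2
    rw [← h2]
    exact measureReal_mono (fun x hx => mem_closedBall_zero_iff.2 (hCu h hh hc j x hx))
      measure_closedBall_lt_top.ne
  have h3 : (C * h j) ^ n * κ ≤ (C * m) ^ n * κ := by
    have := (hh j).le
    gcongr
  linarith

theorem exists_critical_norm_le {u : ι → E n} {α : ι → ℝ} {p : ℝ} (hn : n ≠ 0) (hp : p < 0)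
    (hu : PositivelySpanning u) (hrel : RelationsPositivelySpan u) (hα : ∀ i, 0 < α i) :
    ∃ R > 0, ∀ h : ι → ℝ, (∀ i, 0 < h i) → IsCritical u α p h → polyVolume u h = 1 →
      ∀ x ∈ polyhedron u h, ‖x‖ ≤ R := by
  obtain ⟨C, hC, hCu⟩ := hrel.exists_norm_le hp hα
  have hV1 : 0 < polyVolume u 1 := hu.polyVolume_pos fun _ => one_pos
  -- If every `h j` exceeded `m`, the volume would be at least `m ^ n * polyVolume u 1 ≥ m *
  -- polyVolume u 1 = polyVolume u 1 + 1 > 1`.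
  set m : ℝ := 1 + (polyVolume u 1)⁻¹ with hm
  have hm1 : 1 < m := by simp [hm, hV1]
  refine ⟨C * m, mul_pos hC (by linarith), fun h hh hc hV x hx => ?_⟩
  obtain ⟨j, hj⟩ : ∃ j, h j ≤ m := by
    by_contra! hlt
    have h1 : polyVolume u (m • 1) ≤ polyVolume u h :=
      hu.polyVolume_mono fun i => by simpa using (hlt i).le
    rw [polyVolume_smul u 1 (by linarith), hV] at h1
    have h2 : m * polyVolume u 1 ≤ m ^ n * polyVolume u 1 :=
      mul_le_mul_of_nonneg_right (le_self_pow₀ hm1.le hn) hV1.le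
    have h3 : m * polyVolume u 1 = polyVolume u 1 + 1 := by
      rw [hm, add_mul, one_mul, inv_mul_cancel₀ hV1.ne']
    linarith
  exact (hCu h hh hc j x hx).trans (by gcongr)

/-- Truncating the support numbers at `R` and translating back to a critical position does not
decrease the functional. -/
theorem exists_bounded_critical_ge {u : ι → E n} (hu₁ : ∀ i, ‖u i‖ = 1) {α : ι → ℝ} {p R : ℝ}
    (hp : p < 0) (hu : PositivelySpanning u) (hα : ∀ i, 0 < α i) (hR : 0 < R) {h : ι → ℝ}
    (hh : ∀ i, 0 < h i) (hc : IsCritical u α p h) (hhR : ∀ x ∈ polyhedron u h, ‖x‖ ≤ R) :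
    ∃ k : ι → ℝ, (∀ i, 0 < k i) ∧ IsCritical u α p k ∧ polyVolume u k = polyVolume u h ∧
      (∀ i, k i ≤ 2 * R) ∧ ∑ i, α i * h i ^ p ≤ ∑ i, α i * k i ^ p := by
  -- A support number may exceed the actual support function when its constraint is redundant, so a
  -- bound on the polyhedron does not bound `h`. Truncation leaves the polyhedron unchanged.
  set h' : ι → ℝ := fun i => min (h i) R with hh'
  have hle : ∀ x : E n, ‖x‖ ≤ R → ∀ i, |inner ℝ x (u i)| ≤ R := fun x hx i => by
    refine (abs_real_inner_le_norm x (u i)).trans ?_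
    rwa [hu₁, mul_one]
  have hP : polyhedron u h' = polyhedron u h :=
    Subset.antisymm (polyhedron_mono u fun i => min_le_left _ _) fun x hx i =>
      le_min (hx i) ((le_abs_self _).trans (hle x (hhR x hx) i))
  obtain ⟨ξ, hξ, hξc⟩ := exists_translate_isCritical hp hu hα
    (h := h') (fun i => lt_min (hh i) hR)
  refine ⟨_, hξ, hξc, ?_, fun i => ?_, hc.sum_le_sum hp hα hh (fun i => min_le_left _ _) hξ⟩
  · rw [polyVolume_translate, polyVolume, hP, polyVolume]
  -- The translation vector lies in the polyhedron, so `|ξ · u i| ≤ R`; adding `h' i ≤ R` gives `2 *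
  -- R`.
  · have hξP : ξ ∈ polyhedron u h := hP ▸ fun i => by linarith [hξ i]
    have h1 := neg_le_of_abs_le (hle ξ (hhR ξ hξP) i)
    have h2 : h' i ≤ R := min_le_right _ _
    linarith

theorem exists_maximizer {u : ι → E n} (hu₁ : ∀ i, ‖u i‖ = 1) {α : ι → ℝ} {p : ℝ} (hn : n ≠ 0)
    (hp : p < 0) (hu : PositivelySpanning u) (hrel : RelationsPositivelySpan u)
    (hα : ∀ i, 0 < α i) :
    ∃ h : ι → ℝ, (∀ i, 0 < h i) ∧ IsCritical u α p h ∧ polyVolume u h = 1 ∧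
      ∀ k : ι → ℝ, (∀ i, 0 < k i) → IsCritical u α p k → polyVolume u k = 1 →
        ∑ i, α i * k i ^ p ≤ ∑ i, α i * h i ^ p := by
  obtain ⟨m, hm, hmu⟩ := exists_critical_lower_bound hn hp hrel hα
  obtain ⟨R, hR, hRu⟩ := exists_critical_norm_le hn hp hu hrel hα
  let B : Set (ι → ℝ) := Icc (fun _ => m) fun _ => 2 * R
  have hBpos : ∀ h ∈ B, ∀ i, 0 < h i := fun h hh i => hm.trans_le (hh.1 i)
  have hpow : ∀ (q : ℝ) (i : ι), ContinuousOn (fun h : ι → ℝ => h i ^ q) B := fun q i =>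
    ContinuousOn.rpow_const (by fun_prop) fun h hh => Or.inl (hBpos h hh i).ne'
  have hcV : ContinuousOn (polyVolume u) B := fun h hh =>
    (hu.continuousAt_polyVolume (hBpos h hh)).continuousWithinAt
  have hcC : ContinuousOn (fun h : ι → ℝ => ∑ i, (α i * h i ^ (p - 1)) • u i) B :=
    continuousOn_finsetSum _ fun i _ => (continuousOn_const.mul (hpow _ i)).smul continuousOn_const
  have hcΨ : ContinuousOn (fun h : ι → ℝ => ∑ i, α i * h i ^ p) B :=
    continuousOn_finsetSum _ fun i _ => continuousOn_const.mul (hpow _ i)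
  -- The box `B` occurs in both factors because each function is known to be continuous only on `B`,
  -- where all coordinates are positive.
  let K : Set (ι → ℝ) := (B ∩ (fun h => ∑ i, (α i * h i ^ (p - 1)) • u i) ⁻¹' {0}) ∩
    (B ∩ polyVolume u ⁻¹' {1})
  have hK : IsCompact K :=
    (isCompact_Icc.of_isClosed_subset (hcC.preimage_isClosed_of_isClosed isClosed_Icc
      isClosed_singleton) inter_subset_left).inter_right
      (hcV.preimage_isClosed_of_isClosed isClosed_Icc isClosed_singleton)
  have hred : ∀ k : ι → ℝ, (∀ i, 0 < k i) → IsCritical u α p k → polyVolume u k = 1 →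
      ∃ k' ∈ K, ∑ i, α i * k i ^ p ≤ ∑ i, α i * k' i ^ p := by
    intro k hk hkc hkV
    obtain ⟨k', hk', hkc', hkV', hkR, hle⟩ :=
      exists_bounded_critical_ge hu₁ hp hu hα hR hk hkc (hRu k hk hkc hkV)
    rw [hkV] at hkV'
    have hB : k' ∈ B := ⟨hmu k' hk' hkc' hkV', hkR⟩
    exact ⟨k', ⟨⟨hB, hkc'⟩, hB, hkV'⟩, hle⟩
  obtain ⟨ξ, hξ, hξc⟩ := exists_translate_isCritical (h := fun _ => 1) hp hu hα fun _ => one_pos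
  obtain ⟨k, hk, hkc, hkV⟩ := exists_isCritical_polyVolume_eq_one hn hu hξ hξc
  obtain ⟨k', hk', -⟩ := hred k hk hkc hkV
  obtain ⟨h, hhK, hmax⟩ := hK.exists_isMaxOn ⟨k', hk'⟩ (hcΨ.mono fun x hx => hx.1.1)
  refine ⟨h, hBpos h hhK.1.1, hhK.1.2, hhK.2.2, fun k hk hkc hkV => ?_⟩
  obtain ⟨k', hk', hle⟩ := hred k hk hkc hkV
  exact hle.trans (hmax hk')

/-- Normalise `k` to volume one and translate it to a critical position. The tangent inequality at
`h` bounds its functional from below by an expression linear in `k`; the translation drops out by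
criticality of `h`, and maximality bounds the functional from above. Dividing by `p < 0` gives the
claim. -/
theorem sum_mul_le_of_maximizer {u : ι → E n} {α : ι → ℝ} {p : ℝ} (hn : n ≠ 0) (hp : p < 0)
    (hu : PositivelySpanning u) (hα : ∀ i, 0 < α i) {h : ι → ℝ} (hh : ∀ i, 0 < h i)
    (hc : IsCritical u α p h)
    (hmax : ∀ k : ι → ℝ, (∀ i, 0 < k i) → IsCritical u α p k → polyVolume u k = 1 →
        ∑ i, α i * k i ^ p ≤ ∑ i, α i * h i ^ p) {k : ι → ℝ} (hk : ∀ i, 0 < k i) :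
    polyVolume u k ^ (1 / (n : ℝ)) * ∑ i, α i * h i ^ p ≤
      ∑ i, α i * h i ^ (p - 1) * k i := by
  have hL : ∑ i, α i * h i ^ p = ∑ i, α i * h i ^ (p - 1) * h i :=
    Finset.sum_congr rfl fun i _ => by rw [mul_assoc, ← Real.rpow_add_one (hh i).ne']; simp
  have hV0 := hu.polyVolume_pos hk
  set r : ℝ := polyVolume u k ^ (1 / (n : ℝ)) with hr
  have hr0 : 0 < r := Real.rpow_pos_of_pos hV0 _
  have hrn : r ^ n = polyVolume u k := by
    rw [hr, ← Real.rpow_natCast, ← Real.rpow_mul hV0.le,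
      one_div_mul_cancel (Nat.cast_ne_zero.2 hn), Real.rpow_one]
  have hk1 : ∀ i, 0 < (r⁻¹ • k) i := fun i => mul_pos (inv_pos.2 hr0) (hk i)
  have hVk1 : polyVolume u (r⁻¹ • k) = 1 := by
    rw [polyVolume_smul u k (inv_pos.2 hr0), inv_pow, hrn, inv_mul_cancel₀ hV0.ne']
  obtain ⟨ξ, hξ, hξc⟩ := exists_translate_isCritical hp hu hα hk1
  have h1 := hmax _ hξ hξc (by rw [polyVolume_translate, hVk1])
  have h2 : ∑ i, α i * (h i ^ p + p * h i ^ (p - 1) * ((r⁻¹ • k) i - inner ℝ ξ (u i) - h i)) ≤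
      ∑ i, α i * ((r⁻¹ • k) i - inner ℝ ξ (u i)) ^ p :=
    Finset.sum_le_sum fun i _ =>
      mul_le_mul_of_nonneg_left (add_mul_sub_le_rpow hp (hh i) (hξ i)) (hα i).le
  have h3 : ∑ i, α i * h i ^ (p - 1) * inner ℝ ξ (u i) = 0 := by
    rw [sum_mul_inner, hc, inner_zero_right]
  have h4 : ∑ i, α i * (h i ^ p + p * h i ^ (p - 1) * ((r⁻¹ • k) i - inner ℝ ξ (u i) - h i)) =
      ∑ i, α i * h i ^ p + p * (r⁻¹ * ∑ i, α i * h i ^ (p - 1) * k i -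
        ∑ i, α i * h i ^ (p - 1) * inner ℝ ξ (u i) - ∑ i, α i * h i ^ (p - 1) * h i) := by
    simp only [Finset.mul_sum, ← Finset.sum_sub_distrib, ← Finset.sum_add_distrib]
    exact Finset.sum_congr rfl fun i _ => by simp only [Pi.smul_apply, smul_eq_mul]; ring
  rw [h4, h3, ← hL] at h2
  have h5 : 0 ≤ r⁻¹ * ∑ i, α i * h i ^ (p - 1) * k i - 0 - ∑ i, α i * h i ^ p := by
    by_contra! hneg
    nlinarith
  rw [sub_zero, sub_nonneg, ← div_eq_inv_mul, le_div_iff₀ hr0] at h5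
  linarith

theorem exists_facetArea_eq_mul {u : ι → E n} (hu₁ : ∀ i, ‖u i‖ = 1) {α : ι → ℝ} {p : ℝ}
    (hn : n ≠ 0) (hp : p < 0) (hu : PositivelySpanning u) (hpar : PairwiseNonparallel u)
    (hrel : RelationsPositivelySpan u) (hα : ∀ i, 0 < α i) :
    ∃ h : ι → ℝ, (∀ i, 0 < h i) ∧ ∃ c > 0, ∀ j, α j * h j ^ (p - 1) = c * facetArea u h j := by
  classical
  obtain ⟨h, hh, hc, hV, hmax⟩ := exists_maximizer hu₁ hn hp hu hrel hα
  rcases isEmpty_or_nonempty ι with hι | hι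
  · exact ⟨h, hh, 1, one_pos, fun j => isEmptyElim j⟩
  set L := ∑ i, α i * h i ^ p with hL
  have hL0 : 0 < L := Finset.sum_pos (fun i _ => mul_pos (hα i) (Real.rpow_pos_of_pos (hh i) _))
    Finset.univ_nonempty
  refine ⟨h, hh, L / n, div_pos hL0 (Nat.cast_pos.2 (Nat.pos_of_ne_zero hn)), fun j => ?_⟩
  have hsum : ∀ t, ∑ i, α i * h i ^ (p - 1) * Function.update h j t i =
      L + α j * h j ^ (p - 1) * (t - h j) := by
    intro t
    rw [← sub_eq_iff_eq_add', hL, ← Finset.sum_sub_distrib, Finset.sum_eq_single j]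
    · rw [Function.update_self]
      have : h j ^ p = h j ^ (p - 1) * h j := by rw [← Real.rpow_add_one (hh j).ne']; simp
      rw [this]; ring
    · intro i _ hij
      rw [Function.update_of_ne hij, mul_assoc, ← Real.rpow_add_one (hh i).ne']
      simp
    · simp
  have hd1 : HasDerivAt (fun t => L + α j * h j ^ (p - 1) * (t - h j))
      (α j * h j ^ (p - 1)) (h j) := by
    simpa using (((hasDerivAt_id (h j)).sub_const (h j)).const_mul
      (α j * h j ^ (p - 1))).const_add L
  have hd2 := ((hasDerivAt_polyVolume hu₁ hu hpar h j).rpow_const (p := 1 / (n : ℝ))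
    (Or.inl (by simp [hV]))).mul_const L
  have hd := hd1.fun_sub hd2
  -- The gap in `sum_mul_le_of_maximizer` along the variation of the `j`-th support number:
  -- nonnegative for `t > 0` and zero at `t = h j`.
  have hmin : IsLocalMin (fun t => L + α j * h j ^ (p - 1) * (t - h j) -
      polyVolume u (Function.update h j t) ^ (1 / (n : ℝ)) * L) (h j) := by
    filter_upwards [lt_mem_nhds (hh j)] with t ht
    have h1 : ∀ i, 0 < Function.update h j t i := fun i => by
      by_cases hij : i = j
      · subst hij; simpa using ht
      · simpa [hij] using hh i
    have h2 := sum_mul_le_of_maximizer hn hp hu hα hh hc hmax h1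
    rw [hsum] at h2
    simp only [Function.update_eq_self, hV, Real.one_rpow]
    linarith
  have h0 := hmin.hasDerivAt_eq_zero hd
  rw [Function.update_eq_self, hV, Real.one_rpow] at h0
  linear_combination h0

/-- Under dilation by `s`, the product `h j ^ (1 - p) * facetArea u h j` scales by `s ^ (n - p)`,
and `n - p ≠ 0`, so any constant can be absorbed. -/
theorem exists_solution {u : ι → E n} (hu₁ : ∀ i, ‖u i‖ = 1) {α : ι → ℝ} {p : ℝ}
    (hn : n ≠ 0) (hp : p < 0) (hu : PositivelySpanning u) (hpar : PairwiseNonparallel u)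
    (hrel : RelationsPositivelySpan u) (hα : ∀ i, 0 < α i) :
    ∃ h : ι → ℝ, (∀ i, 0 < h i) ∧ ∀ j, α j = h j ^ (1 - p) * facetArea u h j := by
  obtain ⟨h, hh, c, hc, hhc⟩ := exists_facetArea_eq_mul hu₁ hn hp hu hpar hrel hα
  have hn' : ((n - 1 : ℕ) : ℝ) = n - 1 := by
    rw [Nat.cast_sub (Nat.one_le_iff_ne_zero.2 hn), Nat.cast_one]
  have hnp : (n : ℝ) - p ≠ 0 := by
    have : (0 : ℝ) ≤ n := Nat.cast_nonneg n
    linarith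
  set s : ℝ := c ^ (1 / ((n : ℝ) - p)) with hs
  have hs0 : 0 < s := Real.rpow_pos_of_pos hc _
  have hsc : s ^ ((n : ℝ) - p) = c := by
    rw [hs, ← Real.rpow_mul hc.le, one_div_mul_cancel hnp, Real.rpow_one]
  refine ⟨s • h, fun i => mul_pos hs0 (hh i), fun j => ?_⟩
  rw [facetArea_smul u h hs0, Pi.smul_apply, smul_eq_mul, Real.mul_rpow hs0.le (hh j).le]
  have h1 : s ^ (1 - p) * s ^ (n - 1) = c := by
    rw [← Real.rpow_natCast, hn', ← Real.rpow_add hs0, ← hsc]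
    congr 1; ring
  have h2 : h j ^ (p - 1) * h j ^ (1 - p) = 1 := by
    rw [← Real.rpow_add (hh j)]; simp
  calc α j = α j * (h j ^ (p - 1) * h j ^ (1 - p)) := by rw [h2, mul_one]
    _ = (α j * h j ^ (p - 1)) * h j ^ (1 - p) := by ring
    _ = s ^ (1 - p) * h j ^ (1 - p) * (s ^ (n - 1) * facetArea u h j) := by rw [hhc, ← h1]; ring

end Maximizer

/-! ### Outer normals of convex bodies -/

theorem IsOuterUnitNormal.inner_lt {K : Set (E n)} {x y : E n} {u : UnitSphere n}
    (h : IsOuterUnitNormal K x u) (hy : y ∈ interior K) :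
    inner ℝ y (u : E n) < inner ℝ x (u : E n) := by
  have hu : ‖(u : E n)‖ = 1 := norm_eq_of_mem_sphere u
  have hc : ContinuousAt (fun t : ℝ => y + t • (u : E n)) 0 := by fun_prop
  have hev : ∀ᶠ t in 𝓝 (0 : ℝ), y + t • (u : E n) ∈ K :=
    hc.eventually (by simpa using mem_interior_iff_mem_nhds.1 hy)
  obtain ⟨t, ht, ht0⟩ := ((hev.filter_mono nhdsWithin_le_nhds).and
    (self_mem_nhdsWithin (a := (0 : ℝ)) (s := Ioi 0))).exists
  have ht0 : 0 < t := ht0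
  have h1 := h _ ht
  rw [inner_add_left, real_inner_smul_left, real_inner_self_eq_norm_sq, hu] at h1
  linarith

theorem IsOuterUnitNormal.mem_frontier {K : Set (E n)} {x : E n} {u : UnitSphere n}
    (h : IsOuterUnitNormal K x u) (hx : x ∈ K) : x ∈ frontier K :=
  ⟨subset_closure hx, fun hi => (h.inner_lt hi).false⟩

theorem exists_isOuterUnitNormal {K : Set (E n)} (hK : Convex ℝ K) (h0 : 0 ∈ interior K) {x : E n}
    (hx : x ∈ frontier K) : ∃ u : UnitSphere n, IsOuterUnitNormal K x u := by
  obtain ⟨f, hf⟩ := geometric_hahn_banach_open_point hK.interior isOpen_interior hx.2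
  set z : E n := (InnerProductSpace.toDual ℝ (E n)).symm f with hz
  have hfz : ∀ y, f y = inner ℝ y z := fun y => by
    rw [real_inner_comm, hz, InnerProductSpace.toDual_symm_apply]
  have hle : ∀ y ∈ K, inner ℝ y z ≤ inner ℝ x z := by
    intro y hy
    have h1 : y ∈ closure (interior K) := by
      rw [hK.closure_interior_eq_closure_of_nonempty_interior ⟨0, h0⟩]
      exact subset_closure hy
    have h2 : closure (interior K) ⊆ {y | f y ≤ f x} :=
      closure_minimal (fun a ha => (hf a ha).le) (isClosed_le f.continuous continuous_const)
    rw [← hfz, ← hfz]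
    exact h2 h1
  have hz0 : z ≠ 0 := by
    intro h
    have h1 := hf 0 h0
    rw [hfz, hfz, h, inner_zero_right, inner_zero_right] at h1
    exact h1.false
  have hz1 : 0 < ‖z‖ := norm_pos_iff.2 hz0
  refine ⟨⟨‖z‖⁻¹ • z, by simp [norm_smul, hz1.ne']⟩, fun y hy => ?_⟩
  simp only [real_inner_smul_right]
  exact mul_le_mul_of_nonneg_left (hle y hy) (inv_pos.2 hz1).le

theorem supportSet_isOuterUnitNormal {K : Set (E n)} (hK : IsCompact K) {u : UnitSphere n} {x : E n}
    (hx : x ∈ supportSet K u) : IsOuterUnitNormal K x u := fun y hy => by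
  rw [hx.2]
  exact le_csSup (hK.image (by fun_prop : Continuous fun x : E n => inner ℝ x (u : E n))).bddAbove
    (mem_image_of_mem _ hy)

theorem norm_coe_sphere (u : UnitSphere n) : ‖(u : E n)‖ = 1 := norm_eq_of_mem_sphere u

theorem hausdorffMeasure_inter_hyperplanes_sphere {u v : UnitSphere n} (h₁ : v ≠ u)
    (h₂ : (v : E n) ≠ -u) (a b : ℝ) :
    (μHE[n - 1] : Measure (E n))
      ({x | inner ℝ x (v : E n) = b} ∩ {x | inner ℝ x (u : E n) = a}) = 0 :=
  hausdorffMeasure_inter_hyperplanes_eq_zero (norm_coe_sphere u) (norm_coe_sphere v)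
    (fun h => h₁ (Subtype.ext h)) h₂ a b

/-! ### Surface area measures of polytopes -/

/-- A boundary point with two distinct normals is a convex combination of generating points, and
those with nonzero weight all lie on both supporting hyperplanes. So it lies in the hull of one of
finitely many subsets, each contained in the intersection of two non-parallel hyperplanes. -/
theorem hausdorffMeasure_frontier_diff_regularBoundary {P : Set (E n)} (hP : IsPolytope P)
    (h0 : 0 ∈ interior P) :
    (μHE[n - 1] : Measure (E n)) (frontier P \ regularBoundary P) = 0 := by
  classical
  obtain ⟨⟨s, rfl⟩, -⟩ := hP
  let good : Finset (E n) → Prop := fun T => ∃ (u v : UnitSphere n) (a b : ℝ),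
    v ≠ u ∧ (v : E n) ≠ -u ∧ ∀ y ∈ T, inner ℝ y (v : E n) = b ∧ inner ℝ y (u : E n) = a
  have hnull : ∀ T ∈ s.powerset.filter good,
      (μHE[n - 1] : Measure (E n)) (convexHull ℝ (T : Set (E n))) = 0 := by
    intro T hT
    obtain ⟨u, v, a, b, h₁, h₂, hT⟩ := (Finset.mem_filter.1 hT).2
    refine measure_mono_null (convexHull_min (fun y hy => hT y hy) ?_)
      (hausdorffMeasure_inter_hyperplanes_sphere h₁ h₂ a b)
    have hcv : ∀ (w : E n) (c : ℝ), Convex ℝ {x : E n | inner ℝ x w = c} := fun w c =>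
      convex_hyperplane (f := fun x : E n => (inner ℝ x w : ℝ))
        ⟨fun _ _ => inner_add_left _ _ _, fun _ _ => real_inner_smul_left _ _ _⟩ c
    exact (hcv _ _).inter (hcv _ _)
  refine measure_mono_null ?_ ((measure_biUnion_null_iff
    (s.powerset.filter good).countable_toSet).2 hnull)
  rintro x ⟨hx, hreg⟩
  have hxP : x ∈ convexHull ℝ (s : Set (E n)) :=
    (s.finite_toSet.isCompact_convexHull ℝ).isClosed.frontier_subset hx
  obtain ⟨u, hu⟩ := exists_isOuterUnitNormal (convex_convexHull ℝ _) h0 hx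
  obtain ⟨v, hv, hvu⟩ : ∃ v, IsOuterUnitNormal (convexHull ℝ (s : Set (E n))) x v ∧ v ≠ u := by
    by_contra! h
    exact hreg ⟨hx, u, hu, fun v hv => h v hv⟩
  -- Opposite normals cannot occur: with the origin in the interior, `x · u` and `x · v` are both
  -- positive.
  have hne : (v : E n) ≠ -u := by
    intro h
    have h1 := hu.inner_lt h0
    have h2 := hv.inner_lt h0
    rw [inner_zero_left] at h1 h2
    rw [h, inner_neg_right] at h2
    linarith
  obtain ⟨w, hw0, hw1, hwx⟩ := Finset.mem_convexHull'.1 hxP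
  have hface : ∀ u : UnitSphere n, IsOuterUnitNormal (convexHull ℝ (s : Set (E n))) x u →
      ∀ y ∈ s, w y ≠ 0 → inner ℝ y (u : E n) = inner ℝ x (u : E n) := by
    intro u hu y hy hwy
    have hsum : ∑ y ∈ s, w y * (inner ℝ x (u : E n) - inner ℝ y (u : E n)) = 0 := by
      simp only [mul_sub, Finset.sum_sub_distrib, ← Finset.sum_mul, hw1, one_mul]
      rw [← hwx, sum_inner, sub_eq_zero]
      exact Finset.sum_congr rfl fun y _ => real_inner_smul_left _ _ _
    have h1 := (Finset.sum_eq_zero_iff_of_nonneg fun y hy => mul_nonneg (hw0 y hy)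
      (sub_nonneg.2 (hu y (subset_convexHull ℝ _ hy)))).1 hsum y hy
    exact (sub_eq_zero.1 ((mul_eq_zero.1 h1).resolve_left hwy)).symm
  have hxT : x ∈ convexHull ℝ ((s.filter fun y => w y ≠ 0 : Finset (E n)) : Set (E n)) := by
    refine Finset.mem_convexHull'.2 ⟨w, fun y hy => hw0 y (Finset.mem_filter.1 hy).1, ?_, ?_⟩
    · rw [Finset.sum_filter_ne_zero, hw1]
    · rw [← hwx, Finset.sum_filter_of_ne]
      exact fun y _ hy hwy => hy (by rw [hwy, zero_smul])
  refine mem_biUnion (x := s.filter fun y => w y ≠ 0) ?_ hxT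
  refine Finset.mem_coe.2 (Finset.mem_filter.2 ⟨Finset.mem_powerset.2 (Finset.filter_subset _ _),
    u, v, inner ℝ x (u : E n), inner ℝ x (v : E n), hvu, hne, fun y hy => ?_⟩)
  obtain ⟨hy, hwy⟩ := Finset.mem_filter.1 hy
  exact ⟨hface v hv y hy hwy, hface u hu y hy hwy⟩

/-- Take the last point of `K` on the ray from `y` in direction `-w`. A normal `u` there satisfies
`y · u < (y - t • w) · u` with `t ≥ 0`, which forces `u · w < 0`. -/
theorem exists_frontier_point_below {K : Set (E n)} (hK : IsCompact K) {w y : E n} (hw : w ≠ 0)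
    (hy : y ∈ interior K) :
    ∃ t : ℝ, y - t • w ∈ frontier K ∧
      ∀ u : UnitSphere n, IsOuterUnitNormal K (y - t • w) u → inner ℝ (u : E n) w < 0 := by
  have hemb : Topology.IsClosedEmbedding fun t : ℝ => y - t • w :=
    (Homeomorph.subLeft y).isClosedEmbedding.comp (isClosedEmbedding_smul_left hw)
  obtain ⟨t, htK, ht⟩ := (hemb.isCompact_preimage hK).exists_isGreatest
    ⟨0, by simpa using interior_subset hy⟩
  have ht0 : 0 ≤ t := ht (by simpa using interior_subset hy)
  have hfr : y - t • w ∈ frontier K := by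
    refine ⟨subset_closure htK, fun hi => ?_⟩
    have hev : ∀ᶠ s in 𝓝 t, y - s • w ∈ K :=
      hemb.continuous.continuousAt.eventually (mem_interior_iff_mem_nhds.1 hi)
    obtain ⟨s, hs, hst⟩ := ((hev.filter_mono nhdsWithin_le_nhds).and
      (self_mem_nhdsWithin (a := t) (s := Ioi t))).exists
    exact (ht hs).not_gt hst
  refine ⟨t, hfr, fun u hu => ?_⟩
  have h1 := hu.inner_lt hy
  rw [inner_sub_left, real_inner_smul_left, real_inner_comm (u : E n) w] at h1
  by_contra! h2
  have h3 : 0 ≤ t * inner ℝ (u : E n) w := mul_nonneg ht0 h2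
  linarith

/-- The orthogonal projection along `w` is 1-Lipschitz, hence does not increase Hausdorff measure,
and the image of this set contains the open section of the interior by the hyperplane orthogonal to
`w`. -/
theorem hausdorffMeasure_frontier_below_pos {K : Set (E n)} (hK : IsCompact K)
    (h0 : 0 ∈ interior K) {w : E n} (hw : ‖w‖ = 1) :
    0 < (μHE[n - 1] : Measure (E n)) {x | x ∈ frontier K ∧
      ∀ u : UnitSphere n, IsOuterUnitNormal K x u → inner ℝ (u : E n) w < 0} := by
  set L := {x | x ∈ frontier K ∧
      ∀ u : UnitSphere n, IsOuterUnitNormal K x u → inner ℝ (u : E n) w < 0}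
  let π := (Submodule.span ℝ {w})ᗮ.orthogonalProjectionOnto
  have hw0 : w ≠ 0 := by rintro rfl; simp at hw
  have hn : n - 1 = Module.finrank ℝ (Submodule.span ℝ {w})ᗮ := by
    have := finrank_orthogonal hw
    omega
  have hsub : Subtype.val ⁻¹' interior K ⊆ π '' L := by
    intro y hy
    obtain ⟨t, ht, htu⟩ := exists_frontier_point_below hK hw0 hy
    refine ⟨(y : E n) - t • w, ⟨ht, htu⟩, ?_⟩
    have h1 : π w = 0 := Submodule.orthogonalProjectionOnto_orthogonal_apply_eq_zero
      (Submodule.mem_span_singleton_self w)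
    have h2 : π (y : E n) = y := Submodule.orthogonalProjectionOnto_mem_subspace_eq_self y
    rw [map_sub, map_smul, h1, h2, smul_zero, sub_zero]
  have hpos : 0 < (μHE[n - 1] : Measure (Submodule.span ℝ {w})ᗮ) (π '' L) := by
    rw [hn, InnerProductSpace.euclideanHausdorffMeasure_eq_volume]
    refine lt_of_lt_of_le (IsOpen.measure_pos _ ?_ ⟨0, ?_⟩) (measure_mono hsub)
    · exact isOpen_interior.preimage continuous_subtype_val
    · simpa using h0
  have hlip : LipschitzWith 1 π := by
    refine LipschitzWith.of_dist_le_mul fun x y => ?_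
    rw [NNReal.coe_one, one_mul, dist_eq_norm, dist_eq_norm, ← map_sub]
    exact Submodule.norm_orthogonalProjectionOnto_apply_le _ _
  refine hpos.trans_le ?_
  rw [Measure.euclideanHausdorffMeasure_def, Measure.euclideanHausdorffMeasure_def,
    Measure.smul_apply, Measure.smul_apply]
  have h1 := hlip.lipschitzOnWith (s := L).hausdorffMeasure_image_le
    (d := ((n - 1 : ℕ) : ℝ)) (Nat.cast_nonneg _)
  rw [ENNReal.coe_one, ENNReal.one_rpow, one_mul] at h1
  gcongr

theorem measurable_lpDensity (p : ℝ) (K : Set (E n)) : Measurable (lpDensity p K) := by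
  have h1 : Measurable fun x : regularBoundary K => (gaussMap K x : E n) :=
    measurable_subtype_coe.comp (measurable_gaussMap K)
  exact ((measurable_subtype_coe.inner h1).pow_const _).ennreal_ofReal

theorem IsPolytope.isCompact {P : Set (E n)} (hP : IsPolytope P) : IsCompact P := by
  obtain ⟨⟨s, rfl⟩, -⟩ := hP
  exact s.finite_toSet.isCompact_convexHull ℝ

theorem not_concentratedOnClosedHemisphere_lpSurfaceAreaMeasure {P : Set (E n)}
    (hP : IsPolytope P) (h0 : 0 ∈ interior P) (p : ℝ) :
    ¬ ConcentratedOnClosedHemisphere (lpSurfaceAreaMeasure p P) := by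
  rintro ⟨w, hw, hzero⟩
  have hset : (closedHemisphere ⊤ w)ᶜ = {v : UnitSphere n | inner ℝ (v : E n) w < 0} := by
    ext v; simp [closedHemisphere]
  have hm : MeasurableSet {v : UnitSphere n | inner ℝ (v : E n) w < 0} :=
    measurableSet_lt (by fun_prop) (by fun_prop)
  rw [hset, lpSurfaceAreaMeasure_apply p P hm] at hzero
  refine hzero.not_gt ?_
  rw [setLIntegral_pos_iff (measurable_lpDensity p P)]
  have hsupp : Function.support (lpDensity p P) = univ := by
    refine eq_univ_of_forall fun x => ?_
    have h1 := (gaussMap_spec P x).inner_lt h0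
    rw [inner_zero_left] at h1
    exact (ENNReal.ofReal_pos.2 (Real.rpow_pos_of_pos h1 _)).ne'
  rw [hsupp, univ_inter, boundaryMeasure_apply]
  have hlow := hausdorffMeasure_frontier_below_pos hP.isCompact h0 hw
  have hadd := measure_union_le (μ := (μHE[n - 1] : Measure (E n)))
    (Subtype.val '' (gaussMap P ⁻¹' {v : UnitSphere n | inner ℝ (v : E n) w < 0}))
    (frontier P \ regularBoundary P)
  rw [hausdorffMeasure_frontier_diff_regularBoundary hP h0, add_zero] at hadd
  refine hlow.trans_le ((measure_mono ?_).trans hadd)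
  rintro x ⟨hx, hxu⟩
  by_cases hreg : x ∈ regularBoundary P
  · exact Or.inl ⟨⟨x, hreg⟩, hxu _ (gaussMap_spec P ⟨x, hreg⟩), rfl⟩
  · exact Or.inr ⟨hx, hreg⟩

theorem measure_eq_sum_dirac {ι X : Type*} [Fintype ι] [MeasurableSpace X]
    [MeasurableSingletonClass X]
    (μ : Measure X) {v : ι → X} (hv : Function.Injective v) (hμ : μ (range v)ᶜ = 0) :
    μ = ∑ i, μ {v i} • Measure.dirac (v i) := by
  ext s hs
  have h1 : μ s = μ (⋃ i, s ∩ {v i}) := by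
    rw [← inter_iUnion, iUnion_singleton_eq_range]
    refine le_antisymm ?_ (measure_mono inter_subset_left)
    have h2 := measure_union_le (μ := μ) (s ∩ range v) (range v)ᶜ
    rw [hμ, add_zero] at h2
    refine (measure_mono fun x hx => ?_).trans h2
    by_cases hxv : x ∈ range v
    · exact Or.inl ⟨hx, hxv⟩
    · exact Or.inr hxv
  rw [h1, measure_iUnion (fun i j hij => ?_) fun i => hs.inter (measurableSet_singleton _),
    tsum_fintype, Measure.coe_finsetSum, Finset.sum_apply]
  · refine Finset.sum_congr rfl fun i _ => ?_
    rw [Measure.smul_apply, Measure.dirac_apply' _ hs, smul_eq_mul]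
    by_cases hi : v i ∈ s
    · rw [inter_eq_right.2 (singleton_subset_iff.2 hi), indicator_of_mem hi, Pi.one_apply, mul_one]
    · rw [inter_singleton_eq_empty.2 hi, measure_empty, indicator_of_notMem hi, mul_zero]
  · exact (disjoint_singleton.2 (hv.ne hij)).mono inter_subset_right inter_subset_right

/-! ### The surface area measure of a polyhedron given by its half-spaces -/

section PolyhedronMeasure

variable {ι : Type*} {v : ι → UnitSphere n} {h : ι → ℝ}

theorem isOuterUnitNormal_of_mem_facet {x : E n} {i : ι} (hx : inner ℝ x (v i : E n) = h i) :
    IsOuterUnitNormal (polyhedron (fun i => (v i : E n)) h) x (v i) :=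
  fun _ hy => hx ▸ hy i

theorem supportFn_polyhedron {i : ι} {x : E n}
    (hx : x ∈ polyhedron (fun i => (v i : E n)) h) (hxi : inner ℝ x (v i : E n) = h i) :
    supportFn (polyhedron (fun i => (v i : E n)) h) (v i) = h i := by
  refine IsGreatest.csSup_eq ⟨⟨x, hx, hxi⟩, ?_⟩
  rintro _ ⟨y, hy, rfl⟩
  exact hy i

theorem supportSet_polyhedron {i : ι} {x : E n}
    (hx : x ∈ polyhedron (fun i => (v i : E n)) h) (hxi : inner ℝ x (v i : E n) = h i) :
    supportSet (polyhedron (fun i => (v i : E n)) h) (v i) =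
      polyhedron (fun i => (v i : E n)) h ∩ {x | inner ℝ x (v i : E n) = h i} := by
  rw [supportSet, supportFn_polyhedron hx hxi]
  rfl

variable [Fintype ι]

theorem exists_facet_of_mem_frontier {x : E n}
    (hx : x ∈ frontier (polyhedron (fun i => (v i : E n)) h)) :
    ∃ i, inner ℝ x (v i : E n) = h i := by
  by_contra! hne
  refine hx.2 (mem_interior_iff_mem_nhds.2 ?_)
  have hxP := (isClosed_polyhedron _ _).frontier_subset hx
  have : ∀ i, ∀ᶠ y in 𝓝 x, inner ℝ y (v i : E n) < h i := fun i =>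
    (show ContinuousAt (fun y : E n => inner ℝ y (v i : E n)) x by fun_prop).eventually_lt_const
      ((hxP i).lt_of_ne (hne i))
  filter_upwards [eventually_all.2 this] with y hy i using (hy i).le

theorem exists_gaussMap_eq (x : regularBoundary (polyhedron (fun i => (v i : E n)) h)) :
    ∃ i, inner ℝ (x : E n) (v i : E n) = h i ∧ gaussMap _ x = v i := by
  obtain ⟨i, hi⟩ := exists_facet_of_mem_frontier x.2.1
  exact ⟨i, hi, gaussMap_eq (isOuterUnitNormal_of_mem_facet hi)⟩

theorem PositivelySpanning.hausdorffMeasure_facet_ne_top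
    (hu : PositivelySpanning fun i => (v i : E n)) (h : ι → ℝ) (i : ι) :
    (μHE[n - 1] : Measure (E n)) (polyhedron (fun i => (v i : E n)) h ∩
      {x | inner ℝ x (v i : E n) = h i}) ≠ ∞ := by
  rw [hausdorffMeasure_slice (norm_coe_sphere (v i))]
  exact ((isometry_slice (v i : E n) (h i)).isClosedEmbedding.isCompact_preimage
    (hu.isCompact_polyhedron h)).measure_ne_top

/-- The fibre of the Gauss map over `v i` is the facet up to the null set of singular boundary
points, and on it the density is constant. -/
theorem lpSurfaceAreaMeasure_polyhedron_singleton (hv : Function.Injective v)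
    (hu : PositivelySpanning fun i => (v i : E n)) (hh : ∀ i, 0 < h i) (p : ℝ) (i : ι) :
    lpSurfaceAreaMeasure p (polyhedron (fun i => (v i : E n)) h) {v i} =
      ENNReal.ofReal (h i ^ (1 - p)) * (μHE[n - 1] : Measure (E n))
        (polyhedron (fun i => (v i : E n)) h ∩ {x | inner ℝ x (v i : E n) = h i}) := by
  set P := polyhedron (fun i => (v i : E n)) h with hP
  have hdens : ∀ x ∈ gaussMap P ⁻¹' {v i}, lpDensity p P x = ENNReal.ofReal (h i ^ (1 - p)) := by
    intro x hx
    obtain ⟨j, hj, hjx⟩ := exists_gaussMap_eq x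
    have hij : j = i := hv (hjx.symm.trans hx)
    subst hij
    rw [lpDensity, hjx, hj]
  rw [lpSurfaceAreaMeasure_apply p P (measurableSet_singleton _),
    setLIntegral_congr_fun (measurable_gaussMap P (measurableSet_singleton _)) hdens,
    setLIntegral_const, boundaryMeasure_apply]
  congr 1
  refine le_antisymm (measure_mono ?_) ?_
  · rintro _ ⟨x, hx, rfl⟩
    obtain ⟨j, hj, hjx⟩ := exists_gaussMap_eq x
    have hij : j = i := hv (hjx.symm.trans hx)
    subst hij
    exact ⟨(isClosed_polyhedron _ _).frontier_subset x.2.1, hj⟩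
  · have hadd := measure_union_le (μ := (μHE[n - 1] : Measure (E n)))
      (Subtype.val '' (gaussMap P ⁻¹' {v i})) (frontier P \ regularBoundary P)
    rw [hausdorffMeasure_frontier_diff_regularBoundary (hu.isPolytope_polyhedron hh)
      (zero_mem_interior_polyhedron _ hh), add_zero] at hadd
    refine (measure_mono ?_).trans hadd
    rintro x ⟨hx, hxi⟩
    have hxi : inner ℝ x (v i : E n) = h i := hxi
    have hnormal : IsOuterUnitNormal P x (v i) := isOuterUnitNormal_of_mem_facet hxi
    by_cases hreg : x ∈ regularBoundary P
    · exact Or.inl ⟨⟨x, hreg⟩, gaussMap_eq hnormal, rfl⟩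
    · exact Or.inr ⟨hnormal.mem_frontier hx, hreg⟩

theorem lpSurfaceAreaMeasure_polyhedron_compl_range (p : ℝ) :
    lpSurfaceAreaMeasure p (polyhedron (fun i => (v i : E n)) h) (range v)ᶜ = 0 := by
  have hempty : gaussMap (polyhedron (fun i => (v i : E n)) h) ⁻¹' (range v)ᶜ = ∅ := by
    refine eq_empty_of_forall_notMem fun x hx => hx ?_
    obtain ⟨i, -, hi⟩ := exists_gaussMap_eq x
    exact ⟨i, hi.symm⟩
  rw [lpSurfaceAreaMeasure_apply _ _ (finite_range v).measurableSet.compl, hempty,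
    Measure.restrict_empty, lintegral_zero_measure]

/-- Every regular boundary point has some `v i` as its normal, so the support set in any other
direction consists of singular points and is null. -/
theorem facetNormals_polyhedron_subset (hu : PositivelySpanning fun i => (v i : E n))
    (hh : ∀ i, 0 < h i) : facetNormals (polyhedron (fun i => (v i : E n)) h) ⊆ range v := by
  intro u hu0
  by_contra hur
  refine (show 0 < (μHE[n - 1] : Measure (E n)) _ from hu0).ne' (measure_mono_null ?_
    (hausdorffMeasure_frontier_diff_regularBoundary (hu.isPolytope_polyhedron hh)
      (zero_mem_interior_polyhedron _ hh)))
  intro x hx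
  have hnormal := supportSet_isOuterUnitNormal (hu.isCompact_polyhedron h) hx
  refine ⟨hnormal.mem_frontier hx.1, fun hreg => hur ?_⟩
  obtain ⟨i, -, hi⟩ := exists_gaussMap_eq ⟨x, hreg⟩
  exact ⟨i, hi.symm.trans (gaussMap_eq hnormal)⟩

end PolyhedronMeasure

/-! ### Discrete measures without essential subspaces -/

theorem exists_ne_zero_inner_eq_zero (hn : 2 ≤ n) {u : E n} (hu : ‖u‖ = 1) :
    ∃ x : E n, x ≠ 0 ∧ inner ℝ x u = 0 := by
  have hpos : 0 < Module.finrank ℝ (Submodule.span ℝ {u})ᗮ := by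
    have := finrank_orthogonal hu
    omega
  have := Module.finrank_pos_iff.1 hpos
  obtain ⟨x, hx⟩ := exists_ne (0 : (Submodule.span ℝ {u})ᗮ)
  exact ⟨x, fun h => hx (Subtype.ext h), Submodule.mem_orthogonal_singleton_iff_inner_left.1 x.2⟩

/-- An opposite pair would give the relation `u i + u j = 0`, whose vectors lie on a line; a nonzero
`x` orthogonal to it, available as `2 ≤ n`, contradicts the hypothesis. -/
theorem RelationsPositivelySpan.pairwiseNonparallel {ι : Type*} [Fintype ι] (hn : 2 ≤ n)
    {u : ι → E n} (hu₁ : ∀ i, ‖u i‖ = 1) (hinj : Function.Injective u)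
    (hu : RelationsPositivelySpan u) : PairwiseNonparallel u := by
  classical
  refine fun i j hij => ⟨hinj.ne hij, fun heq => ?_⟩
  obtain ⟨x, hx, hxj⟩ := exists_ne_zero_inner_eq_zero hn (hu₁ j)
  obtain ⟨k, hk, hxk⟩ := hu (Pi.single i 1 + Pi.single j 1)
    (add_nonneg (Pi.single_nonneg.2 zero_le_one) (Pi.single_nonneg.2 zero_le_one))
    (fun h0 => by simpa [hij] using congrFun h0 i)
    (by simp [add_smul, Finset.sum_add_distrib, Pi.single_apply, heq]) x hx
  by_cases hki : k = i
  · rw [hki, heq, inner_neg_right, hxj] at hxk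
    simp at hxk
  · by_cases hkj : k = j
    · rw [hkj, hxj] at hxk
      exact hxk.false
    · simp [hki, hkj] at hk

section Discrete

variable {U : Finset (UnitSphere n)} {α : UnitSphere n → ℝ} {μ : Measure (UnitSphere n)}

theorem discrete_apply_compl (hμ : μ = ∑ u ∈ U, ENNReal.ofReal (α u) • Measure.dirac u) :
    μ (U : Set (UnitSphere n))ᶜ = 0 := by
  rw [hμ, Measure.coe_finsetSum, Finset.sum_apply]
  refine Finset.sum_eq_zero fun u hu => ?_
  rw [Measure.smul_apply, Measure.dirac_apply' _ U.finite_toSet.measurableSet.compl,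
    indicator_of_notMem (notMem_compl_iff.2 hu), smul_zero]

theorem discrete_apply_singleton (hμ : μ = ∑ u ∈ U, ENNReal.ofReal (α u) • Measure.dirac u)
    {u : UnitSphere n} (hu : u ∈ U) : μ {u} = ENNReal.ofReal (α u) := by
  rw [hμ, Measure.coe_finsetSum, Finset.sum_apply, Finset.sum_eq_single_of_mem u hu]
  · rw [Measure.smul_apply, Measure.dirac_apply' _ (measurableSet_singleton u),
      indicator_of_mem (mem_singleton u), Pi.one_apply, smul_eq_mul, mul_one]
  · intro b _ hb
    rw [Measure.smul_apply, Measure.dirac_apply' _ (measurableSet_singleton u),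
      indicator_of_notMem (by simpa using hb), smul_zero]

theorem support_discrete (hα : ∀ u ∈ U, 0 < α u)
    (hμ : μ = ∑ u ∈ U, ENNReal.ofReal (α u) • Measure.dirac u) :
    μ.support = (U : Set (UnitSphere n)) := by
  refine Subset.antisymm (Measure.support_subset_of_isClosed U.finite_toSet.isClosed
    (mem_ae_iff.2 (discrete_apply_compl hμ))) fun u hu => ?_
  refine (Measure.mem_support_iff_forall u).2 fun s hs => ?_
  have h1 : 0 < μ {u} := by
    rw [discrete_apply_singleton hμ hu]
    exact ENNReal.ofReal_pos.2 (hα u hu)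
  exact h1.trans_le (measure_mono (singleton_subset_iff.2 (mem_of_mem_nhds hs)))

theorem positivelySpanning_of_not_concentrated
    (hμ : μ = ∑ u ∈ U, ENNReal.ofReal (α u) • Measure.dirac u)
    (hconc : ¬ ConcentratedOnClosedHemisphere μ) :
    PositivelySpanning fun u : U => ((u : UnitSphere n) : E n) := by
  intro x hx
  by_contra! hle
  have hx1 : 0 < ‖x‖ := norm_pos_iff.2 hx
  refine hconc ⟨-(‖x‖⁻¹ • x), by simp [norm_smul, hx1.ne'],
    measure_mono_null (t := (U : Set (UnitSphere n))ᶜ) (fun v hv hvU =>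
      hv ⟨Submodule.mem_top, ?_⟩) (discrete_apply_compl hμ)⟩
  have h1 := hle ⟨v, hvU⟩
  rw [inner_neg_right, real_inner_smul_right, real_inner_comm]
  have := mul_nonpos_of_nonneg_of_nonpos (inv_pos.2 hx1).le h1
  linarith

/-- Let `X` be the span of the vectors with positive coefficient. A vector with nonpositive products
against all of them is orthogonal to `X`, because the weighted sum of these products vanishes. Hence
no hemisphere of `X` contains them, so a proper `X` would be essential. Therefore `X` is the whole
space, and only `x = 0` is orthogonal to it. -/
theorem relationsPositivelySpan_of_not_hasEssentialSubspace
    (hsupp : μ.support = (U : Set (UnitSphere n))) (hess : ¬ HasEssentialSubspace μ) :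
    RelationsPositivelySpan fun u : U => ((u : UnitSphere n) : E n) := by
  intro c hc hc0 hsum
  have hvanish : ∀ x : E n, (∀ u : U, 0 < c u → inner ℝ x ((u : UnitSphere n) : E n) ≤ 0) →
      ∀ u : U, 0 < c u → inner ℝ x ((u : UnitSphere n) : E n) = 0 := by
    intro x hx u hu
    have h1 : ∑ u, c u * inner ℝ x ((u : UnitSphere n) : E n) = 0 := by
      rw [sum_mul_inner, hsum, inner_zero_right]
    have h2 := (Finset.sum_eq_zero_iff_of_nonpos fun u _ => ?_).1 h1 u (Finset.mem_univ u)
    · exact (mul_eq_zero.1 h2).resolve_left hu.ne'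
    · rcases (hc u).lt_or_eq with h3 | h3
      · exact mul_nonpos_of_nonneg_of_nonpos (hc u) (hx u h3)
      · rw [← h3, Pi.zero_apply, zero_mul]
  set X := Submodule.span ℝ ((fun u : U => ((u : UnitSphere n) : E n)) '' {u | 0 < c u}) with hX
  have hmem : ∀ u : U, 0 < c u → ((u : UnitSphere n) : E n) ∈ X := fun u hu =>
    Submodule.subset_span ⟨u, hu, rfl⟩
  have horth : ∀ x : E n, (∀ u : U, 0 < c u → inner ℝ x ((u : UnitSphere n) : E n) = 0) →
      ∀ y ∈ X, inner ℝ x y = 0 := by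
    intro x hx y hy
    have h1 : X ≤ LinearMap.ker (innerₛₗ ℝ x) := Submodule.span_le.2 (by
      rintro _ ⟨u, hu, rfl⟩
      exact hx u hu)
    exact h1 hy
  have htop : X = ⊤ := by
    by_contra hne
    refine hess ⟨X, ?_, ?_, ?_⟩
    · obtain ⟨u, hu⟩ := Function.ne_iff.1 hc0
      have h1 := hmem u ((hc u).lt_of_ne hu.symm)
      refine Module.finrank_pos_iff_exists_ne_zero.2 ⟨⟨_, h1⟩, fun h0 => ?_⟩
      have h2 := norm_coe_sphere (u : UnitSphere n)
      rw [congrArg Subtype.val h0] at h2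
      simp at h2
    · simpa using Submodule.finrank_lt (lt_top_iff_ne_top.2 hne).ne
    · rintro ⟨w, hw, hw1, hsub⟩
      have h1 := hvanish (-w) fun u hu => by
        have h2 := (hsub (a := (u : UnitSphere n)) ⟨hsupp ▸ u.2, hmem u hu⟩).2
        rw [inner_neg_left, real_inner_comm]
        linarith
      have h3 := horth (-w) h1 w hw
      rw [inner_neg_left, real_inner_self_eq_norm_sq, hw1] at h3
      norm_num at h3
  intro x hx
  by_contra! hle
  exact hx (inner_self_eq_zero.1 (horth x (hvanish x hle) x (htop ▸ Submodule.mem_top)))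

theorem exists_polytope_of_discrete (hn : 2 ≤ n) {p : ℝ} (hp : p < 0) (hα : ∀ u ∈ U, 0 < α u)
    (hμ : μ = ∑ u ∈ U, ENNReal.ofReal (α u) • Measure.dirac u)
    (hess : ¬ HasEssentialSubspace μ) (hconc : ¬ ConcentratedOnClosedHemisphere μ) :
    ∃ P : Set (E n), IsPolytope P ∧ 0 ∈ interior P ∧ μ = lpSurfaceAreaMeasure p P ∧
      facetNormals P = μ.support ∧
      ∀ u ∈ facetNormals P, μ {u} = ENNReal.ofReal (supportFn P u ^ (1 - p)) *
        (μHE[n - 1] : Measure (E n)) (supportSet P u) := by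
  have hsupp := support_discrete hα hμ
  have hspan := positivelySpanning_of_not_concentrated hμ hconc
  have hrel := relationsPositivelySpan_of_not_hasEssentialSubspace hsupp hess
  have hinj : Function.Injective fun u : U => ((u : UnitSphere n) : E n) :=
    Subtype.val_injective.comp Subtype.val_injective
  have hnorm : ∀ u : U, ‖((u : UnitSphere n) : E n)‖ = 1 := fun u => norm_coe_sphere _
  obtain ⟨h, hh, hsol⟩ := exists_solution hnorm (α := fun u : U => α u) (by omega) hp hspan
    (hrel.pairwiseNonparallel hn hnorm hinj) hrel fun u => hα u u.2
  set P := polyhedron (fun u : U => ((u : UnitSphere n) : E n)) h with hP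
  have harea : ∀ u : U, (μHE[n - 1] : Measure (E n))
      (P ∩ {x | inner ℝ x ((u : UnitSphere n) : E n) = h u}) = ENNReal.ofReal (facetArea _ h u) :=
    fun u => (ENNReal.ofReal_toReal (hspan.hausdorffMeasure_facet_ne_top h u)).symm
  have hval : ∀ u : U, μ {(u : UnitSphere n)} = ENNReal.ofReal (h u ^ (1 - p)) *
      (μHE[n - 1] : Measure (E n)) (P ∩ {x | inner ℝ x ((u : UnitSphere n) : E n) = h u}) := by
    intro u
    rw [harea, ← ENNReal.ofReal_mul (Real.rpow_nonneg (hh u).le _), ← hsol u,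
      discrete_apply_singleton hμ u.2]
  -- Positive weights make every facet non-empty, so no constraint is redundant and each `h u` is
  -- the true support number.
  have hpos : ∀ u : U, 0 < (μHE[n - 1] : Measure (E n))
      (P ∩ {x | inner ℝ x ((u : UnitSphere n) : E n) = h u}) := by
    intro u
    rw [harea, ENNReal.ofReal_pos]
    have h1 := hα u u.2
    rw [hsol u] at h1
    exact pos_of_mul_pos_right h1 (Real.rpow_nonneg (hh u).le _)
  have hset : ∀ u : U, supportFn P ((u : UnitSphere n) : E n) = h u ∧
      supportSet P ((u : UnitSphere n) : E n) =
        P ∩ {x | inner ℝ x ((u : UnitSphere n) : E n) = h u} := by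
    intro u
    obtain ⟨x, hx, hxu⟩ := nonempty_of_measure_ne_zero (hpos u).ne'
    exact ⟨supportFn_polyhedron (v := Subtype.val) hx hxu,
      supportSet_polyhedron (v := Subtype.val) hx hxu⟩
  have hrange : range (Subtype.val : U → UnitSphere n) = (U : Set (UnitSphere n)) :=
    Subtype.range_coe
  have hfacets : facetNormals P = (U : Set (UnitSphere n)) := by
    refine Subset.antisymm (hrange ▸ facetNormals_polyhedron_subset hspan hh) fun u hu => ?_
    have h1 := hpos ⟨u, hu⟩
    rwa [← (hset ⟨u, hu⟩).2] at h1
  refine ⟨P, hspan.isPolytope_polyhedron hh, zero_mem_interior_polyhedron _ hh, ?_,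
    hfacets.trans hsupp.symm, ?_⟩
  · rw [measure_eq_sum_dirac μ (v := (Subtype.val : U → UnitSphere n)) Subtype.val_injective
      (by rw [hrange]; exact discrete_apply_compl hμ),
      measure_eq_sum_dirac (lpSurfaceAreaMeasure p P) (v := (Subtype.val : U → UnitSphere n))
      Subtype.val_injective (lpSurfaceAreaMeasure_polyhedron_compl_range p)]
    refine Finset.sum_congr rfl fun u _ => ?_
    rw [hval u, lpSurfaceAreaMeasure_polyhedron_singleton (v := (Subtype.val : U → UnitSphere n))
      Subtype.val_injective hspan hh p u]
  · intro u hu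
    rw [hfacets] at hu
    rw [(hset ⟨u, hu⟩).1, (hset ⟨u, hu⟩).2]
    exact hval ⟨u, hu⟩

end Discrete

end LpMinkowski

theorem theorem1p1 {n : ℕ} (hn : 2 ≤ n) (p : ℝ) (hp : p < 0)
    (μ : MeasureTheory.Measure (LpMinkowski.UnitSphere n)) (hμ : LpMinkowski.IsDiscrete μ) :
    ((∃ P : Set (LpMinkowski.E n), LpMinkowski.IsPolytope P ∧ 0 ∈ interior P ∧
          μ = LpMinkowski.lpSurfaceAreaMeasure p P ∧
          ¬ LpMinkowski.HasEssentialSubspace (LpMinkowski.lpSurfaceAreaMeasure p P)) ↔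
        (¬ LpMinkowski.HasEssentialSubspace μ ∧
          ¬ LpMinkowski.ConcentratedOnClosedHemisphere μ)) ∧
      (¬ LpMinkowski.HasEssentialSubspace μ → ¬ LpMinkowski.ConcentratedOnClosedHemisphere μ →
        ∃ P : Set (LpMinkowski.E n), LpMinkowski.IsPolytope P ∧ 0 ∈ interior P ∧
          μ = LpMinkowski.lpSurfaceAreaMeasure p P ∧
          LpMinkowski.facetNormals P = μ.support ∧
          ∀ u ∈ LpMinkowski.facetNormals P,
            μ {u} = ENNReal.ofReal (LpMinkowski.supportFn P u ^ (1 - p)) *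
              (μHE[n - 1] : MeasureTheory.Measure (LpMinkowski.E n))
                (LpMinkowski.supportSet P u)) := by
  obtain ⟨U, α, hα, hU⟩ := hμ
  refine ⟨⟨?_, ?_⟩, LpMinkowski.exists_polytope_of_discrete hn hp hα hU⟩
  · rintro ⟨P, hP, h0, rfl, hess⟩
    exact ⟨hess, LpMinkowski.not_concentratedOnClosedHemisphere_lpSurfaceAreaMeasure hP h0 p⟩
  · rintro ⟨hess, hconc⟩
    obtain ⟨P, hP, h0, hμP, -⟩ := LpMinkowski.exists_polytope_of_discrete hn hp hα hU hess hconc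
    exact ⟨P, hP, h0, hμP, hμP ▸ hess⟩
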